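/- **Notation.** Let $d\ge 1$ and $s\ge 1$ be integers and $\beta>-d-s$. Let $(a)_n=a(a+1)\cdots(a+n-1)$. Let $\mathcal H_m^{d,0}$ be the space of real homogeneous harmonic polynomials of degree $m$ in $d$ variables ($\mathcal H^{d,0}_m=\{0\}$ if $m<0$), $d\sigma$ the surface measure and $\omega_d$ the area of $\mathbb S^{d-1}$, and $\{Y_\ell^m: 1\le \ell\le\dim\mathcal H_m^{d,0}\}$ a basis of $\mathcal H_m^{d,0}$ that is orthonormal for $\frac1{\omega_d}\int_{\mathbb S^{d-1}}fg\,d\sigma$. Let $$P_n^{(a,b)}(u)=\frac1{n!}\sum_{k=0}^n\binom nk (n+a+b+1)_k\,(a+k+1)_{n-k}\Big(\frac{u-1}2\Big)^k$$ be the Jacobi polynomial, $A_n^{(a,b)}=\dfrac{2^n}{(n+a+b+1)_n}$, and for $a>-1-s$ $$J_n^{(a,-s)}(u)=\begin{cases}\dfrac{(u+1)^n}{n!}, & 0\le n\le s-1,\\[2mm] \displaystyle\int_{-1}^u\frac{(u-v)^{s-1}}{(s-1)!}\,A_{n-s}^{(a+s,0)}P_{n-s}^{(a+s,0)}(v)\,dv,&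 n\ge s.\end{cases}$$ For $0\le m\le n$ put $$\mathsf S^{n,(\beta,-s)}_{m,\ell}(x,t)=J^{(2m+\beta+d-1,-s)}_{n-m}(1-2t)\,Y^m_\ell(x),\qquad \mathsf S^{n,(\beta,\gamma)}_{m,\ell}(x,t)=P^{(2m+\beta+d-1,\gamma)}_{n-m}(1-2t)\,Y^m_\ell(x)\quad(\gamma>-1).$$ On the conic surface $\mathbb V_0^{d+1}=\{(x,t)\in\mathbb R^d\times\mathbb R:\|x\|=t,\ 0\le t\le1\}$ let $\int f\,d\mathsf m=\int_0^1t^{d-1}\int_{\mathbb S^{d-1}}f(t\xi,t)\,d\sigma(\xi)\,dt$. For $\beta>-d$ and $\gamma>-1$, $\mathcal V_n^d(\mathsf w_{\beta,\gamma})$ is the space of polynomials of degree at most $n$ restricted to $\mathbb V_0^{d+1}$ that are orthogonal to all polynomials of degree less than $n$ with respect to $\langle f,g\rangle_{\beta,\gamma}=b_{\beta,\gamma}\int fg\,t^\beta(1-t)^\gamma\,d\mathsf m$, where $b_{\beta,\gamma}$ normalizes $\langle1,1\rangle_{\beta,\gamma}=1$; it is $\{0\}$ for $n<0$. For fixed positive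 $\lambda_0,\dots,\lambda_{s-1}$ and $\beta>-d-s$, $\mathcal V_n^d(\mathsf w_{\beta,-s})$ is the space of polynomials of degree at most $n$ on $\mathbb V_0^{d+1}$ that are orthogonal to all polynomials on $\mathbb V_0^{d+1}$ of degree less than $n$ with respect to $$\langle f,g\rangle_{\beta,-s}=\frac1{\omega_d}\int \partial_t^sf\,\partial_t^sg\;t^{\beta+s}\,d\mathsf m+\sum_{k=0}^{s-1}\frac{\lambda_k}{\omega_d}\int_{\mathbb S^{d-1}}\partial_t^kf(\xi,1)\,\partial_t^kg(\xi,1)\,d\sigma(\xi).$$ Here a polynomial on $\mathbb V_0^{d+1}$ is represented by the unique polynomial in $(x,t)$ with that restriction that is harmonic in $x$, that is, by $\sum_i p_i(t)Y_i(x)$ with solid harmonics $Y_i$, its degree is the degree of this representative, and $\partial_t$ is the derivative in $t$ with $x$ fixed. **Statement.** (i) Let $\beta>-d-s$. For $0\le m\le n$, $1\le\ell\le\dim\mathcal H_m^{d,0}$ and all $(x,t)\in\mathbb R^d\times\mathbb R$, $$\mathsf S_{m,\ell}^{n,(\beta,-s)}(x,t)=\begin{cases} b_{m,n}^s\,(1-t)^s\,\mathsf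 S_{m,\ell}^{n-s,(\beta,s)}(x,t), & n-m\ge s,\\[1mm] \dfrac{2^{n-m}}{(n-m)!}\,(1-t)^{n-m}\,Y_\ell^m(x), & 0\le n-m\le s-1,\end{cases}\qquad b_{m,n}^s=\frac{(-1)^s2^sA_{n-s-m}^{(2m+\beta+d-1,s)}}{(-(n-m))_s}.$$ (ii) If moreover $\beta>-d$ (so that $\mathcal V^d_{n-s}(\mathsf w_{\beta,s})$ is defined), then for every $n\ge0$, as spaces of functions on $\mathbb V_0^{d+1}$, $$\mathcal V_n^d(\mathsf w_{\beta,-s})=\bigoplus_{j=0}^{s-1}(1-t)^j\,\mathcal H_{n-j}^{d,0}\;\oplus\;(1-t)^s\,\mathcal V_{n-s}^d(\mathsf w_{\beta,s}).$$ -/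

import Mathlib

open MeasureTheory

noncomputable section

namespace ConeSobolev

/-! ### One-variable polynomials -/

/-- The Pochhammer symbol `(a)_n = a (a + 1) ⋯ (a + n - 1)`. -/
def poch (a : ℝ) (n : ℕ) : ℝ := (ascPochhammer ℝ n).eval a

/-- The Jacobi polynomial
`P_n^{(α,β)}(x) = (α+1)_n / n! * ₂F₁(-n, n+α+β+1; α+1; (1-x)/2)`.
The hypergeometric sum is written with the quotient `(α+1)_n / (α+1)_k = (α+k+1)_{n-k}` cancelled
and with `(-n)_k / k! = (-1)^k * n.choose k`, so that it is a polynomial in `α`, `β`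
and is meaningful for all real parameters. -/
def jacobiP (α β : ℝ) (n : ℕ) (x : ℝ) : ℝ :=
  (1 / (n.factorial : ℝ)) * ∑ k ∈ Finset.range (n + 1),
    (n.choose k : ℝ) * poch (n + α + β + 1) k * poch (α + k + 1) (n - k) * ((x - 1) / 2) ^ k

/-- `A_n^{(α,β)} = 2^n / (n+α+β+1)_n`. -/
def jacobiA (α β : ℝ) (n : ℕ) : ℝ := 2 ^ n / poch (n + α + β + 1) n

/-- The renormalized Jacobi polynomial `A_n^{(α,β)} P_n^{(α,β)}`. -/
def jacobiHat (α β : ℝ) (n : ℕ) (x : ℝ) : ℝ := jacobiA α β n * jacobiP α β n x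

/-- The extension `J_n^{(α-s,β-s)}` of the Jacobi polynomials (for `α, β > -1` and `s ≥ 1`):
`(t+1)^n / n!` for `n < s`, and the `s`-fold antiderivative
`∫_{-1}^t (t-u)^{s-1}/(s-1)! * A_{n-s} P_{n-s}^{(α,β)}(u) du` for `n ≥ s`. -/
def jacobiJ (α β : ℝ) (s n : ℕ) (t : ℝ) : ℝ :=
  if n < s then (t + 1) ^ n / (n.factorial : ℝ)
  else ∫ u in (-1 : ℝ)..t, (t - u) ^ (s - 1) / ((s - 1).factorial : ℝ) * jacobiHat α β (n - s) u

/-! ### Polynomials in `(x,t)`, solid harmonics, and the cone -/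

/-- The Laplace operator on polynomials in `d` variables. -/
def laplacian (d : ℕ) :
    MvPolynomial (Fin d) ℝ →ₗ[ℝ] MvPolynomial (Fin d) ℝ :=
  ∑ i : Fin d, (MvPolynomial.pderiv i).toLinearMap ∘ₗ (MvPolynomial.pderiv i).toLinearMap

/-- The space `H_m^{d,0}` of homogeneous solid harmonics of degree `m` in `d` variables. -/
def solidHarmonics (d m : ℕ) : Submodule ℝ (MvPolynomial (Fin d) ℝ) :=
  MvPolynomial.homogeneousSubmodule (Fin d) ℝ m ⊓ LinearMap.ker (laplacian d)

/-- The polynomial ring `ℝ[x,t]`: the variable `some i` is `x_i`, the variable `none` is `t`. -/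
abbrev Poly (d : ℕ) := MvPolynomial (Option (Fin d)) ℝ

/-- The partial derivative `∂_t` with respect to the last variable (`x` is kept fixed). -/
def dt (d : ℕ) : Poly d →ₗ[ℝ] Poly d := (MvPolynomial.pderiv none).toLinearMap

/-- The Laplace operator in the `x` variables on `ℝ[x,t]`. -/
def laplacianX (d : ℕ) : Poly d →ₗ[ℝ] Poly d :=
  ∑ i : Fin d, (MvPolynomial.pderiv (some i)).toLinearMap ∘ₗ
    (MvPolynomial.pderiv (some i)).toLinearMap

/-- The value of a polynomial in `d` variables at a point of Euclidean space. -/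
def evalX {d : ℕ} (p : MvPolynomial (Fin d) ℝ) (x : EuclideanSpace ℝ (Fin d)) : ℝ :=
  MvPolynomial.eval (fun i => x i) p

/-- The value `P(x,t)`. -/
def evalXT {d : ℕ} (P : Poly d) (x : EuclideanSpace ℝ (Fin d)) (t : ℝ) : ℝ :=
  MvPolynomial.eval (fun o : Option (Fin d) => o.elim t (fun i => x i)) P

/-- The conic surface `{(x,t) : ‖x‖ = t, 0 ≤ t ≤ 1}`. -/
def cone (d : ℕ) : Set (EuclideanSpace ℝ (Fin d) × ℝ) :=
  {p | ‖p.1‖ = p.2 ∧ 0 ≤ p.2 ∧ p.2 ≤ 1}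

/-- Restriction of a polynomial in `(x,t)` to the conic surface. -/
def restrict (d : ℕ) : Poly d →ₗ[ℝ] (cone d → ℝ) where
  toFun P := fun p => evalXT P p.1.1 p.1.2
  map_add' P Q := by ext p; simp [evalXT]
  map_smul' c P := by ext p; simp [evalXT]

/-- The surface measure `dσ` of the unit sphere. -/
def sphereMeasure (d : ℕ) :
    Measure (Metric.sphere (0 : EuclideanSpace ℝ (Fin d)) 1) :=
  (volume : Measure (EuclideanSpace ℝ (Fin d))).toSphere

/-- The surface area `ω_d = 2 π^{d/2} / Γ(d/2)` of the unit sphere. -/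
def omega (d : ℕ) : ℝ := 2 * Real.pi ^ ((d : ℝ) / 2) / Real.Gamma ((d : ℝ) / 2)

/-- The integral over the unit sphere. -/
def sphereIntegral (d : ℕ) (f : EuclideanSpace ℝ (Fin d) → ℝ) : ℝ :=
  ∫ ξ, f ξ ∂(sphereMeasure d)

/-- The integral over the conic surface,
`∫ f dm = ∫_0^1 t^{d-1} ∫_{S^{d-1}} f(tξ,t) dσ(ξ) dt`. -/
def coneIntegral (d : ℕ) (f : EuclideanSpace ℝ (Fin d) → ℝ → ℝ) : ℝ :=
  ∫ t in (0 : ℝ)..1, t ^ (d - 1) * sphereIntegral d (fun ξ => f (t • ξ) t)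

/-- The Jacobi weight `w_{β,γ}(t) = t^β (1-t)^γ`. -/
def weight (β γ t : ℝ) : ℝ := t ^ β * (1 - t) ^ γ

/-- The normalization constant
`b_{β,γ} = ω_d⁻¹ Γ(β+γ+d+1) / (Γ(β+d) Γ(γ+1))`, for which `⟨1,1⟩_{β,γ} = 1`. -/
def normConst (d : ℕ) (β γ : ℝ) : ℝ :=
  1 / omega d * (Real.Gamma (β + γ + d + 1) / (Real.Gamma (β + d) * Real.Gamma (γ + 1)))

/-- The inner product `⟨P,Q⟩_{β,γ} = b_{β,γ} ∫ P Q w_{β,γ} dm` over the conic surface. -/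
def coneInner (d : ℕ) (β γ : ℝ) (P Q : Poly d) : ℝ :=
  normConst d β γ * coneIntegral d (fun x t => evalXT P x t * evalXT Q x t * weight β γ t)

/-- The Sobolev inner product `⟨P,Q⟩_{β,-s}`:
`ω_d⁻¹ ∫ ∂_t^s P ∂_t^s Q t^{β+s} dm + ∑_{k<s} λ_k ω_d⁻¹ ∫_{S^{d-1}} ∂_t^k P(ξ,1) ∂_t^k Q(ξ,1) dσ(ξ)`. -/
def sobolevInner (d : ℕ) (β : ℝ) (s : ℕ) (lam : ℕ → ℝ) (P Q : Poly d) : ℝ :=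
  1 / omega d * coneIntegral d (fun x t =>
      evalXT ((dt d)^[s] P) x t * evalXT ((dt d)^[s] Q) x t * t ^ (β + s))
    + ∑ k ∈ Finset.range s, lam k / omega d * sphereIntegral d (fun ξ =>
        evalXT ((dt d)^[k] P) ξ 1 * evalXT ((dt d)^[k] Q) ξ 1)

/-! ### Bilinearity of the two inner products on polynomials -/

lemma continuous_evalXT {d : ℕ} (P : Poly d) :
    Continuous (fun p : EuclideanSpace ℝ (Fin d) × ℝ => evalXT P p.1 p.2) := by
  unfold evalXT
  refine (MvPolynomial.continuous_eval P).comp ?_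
  refine continuous_pi fun o => ?_
  cases o with
  | none => simpa using continuous_snd
  | some i => simp only [Option.elim]; fun_prop

@[simp] lemma evalXT_add {d : ℕ} (P Q : Poly d) (x : EuclideanSpace ℝ (Fin d)) (t : ℝ) :
    evalXT (P + Q) x t = evalXT P x t + evalXT Q x t := by simp [evalXT]

@[simp] lemma evalXT_smul {d : ℕ} (c : ℝ) (P : Poly d) (x : EuclideanSpace ℝ (Fin d)) (t : ℝ) :
    evalXT (c • P) x t = c * evalXT P x t := by simp [evalXT]

instance (d : ℕ) : IsFiniteMeasure (sphereMeasure d) := by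
  unfold sphereMeasure; infer_instance

lemma sphereIntegral_add {d : ℕ} {f g : EuclideanSpace ℝ (Fin d) → ℝ}
    (hf : Continuous f) (hg : Continuous g) :
    sphereIntegral d (fun x => f x + g x) = sphereIntegral d f + sphereIntegral d g := by
  have key : ∀ h : EuclideanSpace ℝ (Fin d) → ℝ, Continuous h →
      Integrable (fun ξ : Metric.sphere (0 : EuclideanSpace ℝ (Fin d)) 1 => h ξ)
        (sphereMeasure d) := fun h hh => by
    have := (hh.comp continuous_subtype_val).continuousOn.integrableOn_compact
      (μ := sphereMeasure d) (isCompact_univ (X := Metric.sphere (0 : EuclideanSpace ℝ (Fin d)) 1))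
    exact integrableOn_univ.mp this
  exact integral_add (key f hf) (key g hg)

lemma sphereIntegral_const_mul {d : ℕ} (c : ℝ) (f : EuclideanSpace ℝ (Fin d) → ℝ) :
    sphereIntegral d (fun x => c * f x) = c * sphereIntegral d f :=
  integral_const_mul c _

lemma sphereIntegral_mul_const {d : ℕ} (c : ℝ) (f : EuclideanSpace ℝ (Fin d) → ℝ) :
    sphereIntegral d (fun x => f x * c) = sphereIntegral d f * c :=
  integral_mul_const c _

lemma coneIntegral_const_mul {d : ℕ} (c : ℝ) (f : EuclideanSpace ℝ (Fin d) → ℝ → ℝ) :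
    coneIntegral d (fun x t => c * f x t) = c * coneIntegral d f := by
  simp only [coneIntegral, sphereIntegral_const_mul, ← intervalIntegral.integral_const_mul]
  congr 1; ext t; ring

lemma coneIntegral_add {d : ℕ} {w : ℝ → ℝ}
    (hw : IntervalIntegrable (fun t => t ^ (d - 1) * w t) volume 0 1)
    {f g : EuclideanSpace ℝ (Fin d) → ℝ → ℝ}
    (hf : Continuous fun p : EuclideanSpace ℝ (Fin d) × ℝ => f p.1 p.2)
    (hg : Continuous fun p : EuclideanSpace ℝ (Fin d) × ℝ => g p.1 p.2) :
    coneIntegral d (fun x t => (f x t + g x t) * w t) =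
      coneIntegral d (fun x t => f x t * w t) + coneIntegral d (fun x t => g x t * w t) := by
  have key : ∀ h : EuclideanSpace ℝ (Fin d) → ℝ → ℝ,
      Continuous (fun p : EuclideanSpace ℝ (Fin d) × ℝ => h p.1 p.2) →
      IntervalIntegrable
        (fun t => t ^ (d - 1) * (sphereIntegral d (fun ξ => h (t • ξ) t) * w t)) volume 0 1 := by
    intro h hh
    have hc : Continuous (fun t : ℝ => sphereIntegral d (fun ξ => h (t • ξ) t)) := by
      unfold sphereIntegral
      have hu : Continuous (Function.uncurry (fun (t : ℝ)
          (ξ : Metric.sphere (0 : EuclideanSpace ℝ (Fin d)) 1) =>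
            h (t • (ξ : EuclideanSpace ℝ (Fin d))) t)) :=
        hh.comp (f := fun q : ℝ × Metric.sphere (0 : EuclideanSpace ℝ (Fin d)) 1 =>
          (q.1 • (q.2 : EuclideanSpace ℝ (Fin d)), q.1)) (by fun_prop)
      have := continuous_parametric_integral_of_continuous (μ := sphereMeasure d) hu
        (isCompact_univ (X := Metric.sphere (0 : EuclideanSpace ℝ (Fin d)) 1))
      simpa using this
    have := hw.mul_continuousOn hc.continuousOn
    refine this.congr ?_
    exact fun t _ => by ring
  simp only [coneIntegral, sphereIntegral_mul_const]
  rw [← intervalIntegral.integral_add (key f hf) (key g hg)]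
  congr 1; ext t
  rw [sphereIntegral_add (f := fun ξ => f (t • ξ) t) (g := fun ξ => g (t • ξ) t)
    (hf.comp (f := fun ξ : EuclideanSpace ℝ (Fin d) => (t • ξ, t)) (by fun_prop))
    (hg.comp (f := fun ξ : EuclideanSpace ℝ (Fin d) => (t • ξ, t)) (by fun_prop))]
  ring

lemma intervalIntegrable_rpow_mul {a c : ℝ} (ha : -1 < a) (hc : -1 < c) :
    IntervalIntegrable (fun t : ℝ => t ^ a * (1 - t) ^ c) volume 0 1 := by
  have h := (Complex.betaIntegral_convergent (u := ((a + 1 : ℝ) : ℂ)) (v := ((c + 1 : ℝ) : ℂ))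
    (by simpa using by linarith) (by simpa using by linarith)).norm
  refine h.congr_ae ?_
  rw [Set.uIoc_of_le zero_le_one]
  have h1 : ∀ᵐ t : ℝ, t ≠ 1 := by simp [ae_iff]
  filter_upwards [ae_restrict_mem measurableSet_Ioc, ae_restrict_of_ae h1] with t ht ht1
  have ht0 : 0 < t := ht.1
  have ht2 : 0 < 1 - t := by
    have := lt_of_le_of_ne ht.2 ht1
    linarith
  have e : (1 : ℂ) - (t : ℂ) = ((1 - t : ℝ) : ℂ) := by push_cast; ring
  rw [e, norm_mul, Complex.norm_cpow_eq_rpow_re_of_pos ht0,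
    Complex.norm_cpow_eq_rpow_re_of_pos ht2]
  simp

lemma intervalIntegrable_weight {d : ℕ} {β γ : ℝ} (hβ : -(d : ℝ) < β) (hγ : -1 < γ) :
    IntervalIntegrable (fun t => t ^ (d - 1) * weight β γ t) volume 0 1 := by
  rcases Nat.eq_zero_or_pos d with rfl | hd
  · have : -1 < β := by simp at hβ; linarith
    simpa [weight] using intervalIntegrable_rpow_mul this hγ
  · have hc : ((d - 1 : ℕ) : ℝ) = (d : ℝ) - 1 := by simp [Nat.cast_sub hd]
    refine (intervalIntegrable_rpow_mul (a := ((d - 1 : ℕ) : ℝ) + β) (by rw [hc]; linarith)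
      hγ).congr ?_
    rw [Set.uIoc_of_le zero_le_one]
    intro t ht
    simp only [weight]
    rw [Real.rpow_add ht.1, Real.rpow_natCast, mul_assoc]

lemma coneInner_add_left {d : ℕ} {β γ : ℝ} (hβ : -(d : ℝ) < β) (hγ : -1 < γ) (P P' Q : Poly d) :
    coneInner d β γ (P + P') Q = coneInner d β γ P Q + coneInner d β γ P' Q := by
  simp only [coneInner, evalXT_add, add_mul (evalXT P _ _)]
  rw [coneIntegral_add (intervalIntegrable_weight hβ hγ)
    ((continuous_evalXT P).mul (continuous_evalXT Q))
    ((continuous_evalXT P').mul (continuous_evalXT Q)), mul_add]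

lemma coneInner_smul_left {d : ℕ} {β γ : ℝ} (c : ℝ) (P Q : Poly d) :
    coneInner d β γ (c • P) Q = c * coneInner d β γ P Q := by
  simp only [coneInner, evalXT_smul, mul_assoc, coneIntegral_const_mul]
  ring

lemma dt_iterate_add {d : ℕ} (k : ℕ) (P Q : Poly d) :
    (dt d)^[k] (P + Q) = (dt d)^[k] P + (dt d)^[k] Q := iterate_map_add (dt d) k P Q

lemma dt_iterate_smul {d : ℕ} (k : ℕ) (c : ℝ) (P : Poly d) :
    (dt d)^[k] (c • P) = c • (dt d)^[k] P := by
  induction k generalizing P with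
  | zero => rfl
  | succ k ih => simp only [Function.iterate_succ_apply, map_smul, ih]

lemma sobolevInner_add_left {d : ℕ} {β : ℝ} {s : ℕ} (hβ : -(d : ℝ) - s < β) (lam : ℕ → ℝ)
    (P P' Q : Poly d) :
    sobolevInner d β s lam (P + P') Q =
      sobolevInner d β s lam P Q + sobolevInner d β s lam P' Q := by
  have hw : IntervalIntegrable (fun t : ℝ => t ^ (d - 1) * t ^ (β + s)) volume 0 1 := by
    have := intervalIntegrable_weight (d := d) (β := β + s) (γ := 0) (by linarith) (by norm_num)
    simpa [weight] using this
  have hc : ∀ R : Poly d, Continuous fun x : EuclideanSpace ℝ (Fin d) => evalXT R x 1 :=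
    fun R => (continuous_evalXT R).comp (f := fun x : EuclideanSpace ℝ (Fin d) => (x, (1 : ℝ)))
      (by fun_prop)
  simp only [sobolevInner, dt_iterate_add, evalXT_add, add_mul (evalXT _ _ _)]
  rw [coneIntegral_add hw
    ((continuous_evalXT ((dt d)^[s] P)).mul (continuous_evalXT ((dt d)^[s] Q)))
    ((continuous_evalXT ((dt d)^[s] P')).mul (continuous_evalXT ((dt d)^[s] Q)))]
  have hs : ∀ k, sphereIntegral d (fun ξ =>
      evalXT ((dt d)^[k] P) ξ 1 * evalXT ((dt d)^[k] Q) ξ 1 +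
        evalXT ((dt d)^[k] P') ξ 1 * evalXT ((dt d)^[k] Q) ξ 1) = _ :=
    fun k => sphereIntegral_add ((hc _).mul (hc _)) ((hc _).mul (hc _))
  simp only [hs, mul_add, Finset.sum_add_distrib]
  ring

lemma sobolevInner_smul_left {d : ℕ} {β : ℝ} {s : ℕ} (lam : ℕ → ℝ) (c : ℝ) (P Q : Poly d) :
    sobolevInner d β s lam (c • P) Q = c * sobolevInner d β s lam P Q := by
  simp only [sobolevInner, dt_iterate_smul, evalXT_smul, mul_assoc, coneIntegral_const_mul,
    sphereIntegral_const_mul, mul_add, Finset.mul_sum]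
  congr 1
  · ring
  · exact Finset.sum_congr rfl fun k _ => by ring

lemma coneInner_zero_left {d : ℕ} {β γ : ℝ} (Q : Poly d) : coneInner d β γ 0 Q = 0 := by
  simpa using coneInner_smul_left (β := β) (γ := γ) 0 0 Q

lemma sobolevInner_zero_left {d : ℕ} {β : ℝ} {s : ℕ} (lam : ℕ → ℝ) (Q : Poly d) :
    sobolevInner d β s lam 0 Q = 0 := by
  simpa using sobolevInner_smul_left (β := β) (s := s) lam 0 0 Q

/-! ### Spaces of orthogonal polynomials on the cone -/

/-- The space `V_n^d(w_{β,γ})` (`β > -d`, `γ > -1`) of orthogonal polynomials of degree `n` on the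
conic surface: restrictions to the cone of polynomials of degree at most `n` in `(x,t)` that are
orthogonal to all polynomials of degree less than `n` for `⟨·,·⟩_{β,γ}`. -/
def orthPoly (d : ℕ) (β γ : ℝ) (hβ : -(d : ℝ) < β) (hγ : -1 < γ) (n : ℕ) :
    Submodule ℝ (cone d → ℝ) where
  carrier := {f | ∃ P : Poly d, P.totalDegree ≤ n ∧ restrict d P = f ∧
    ∀ Q : Poly d, Q.totalDegree < n → coneInner d β γ P Q = 0}
  zero_mem' := ⟨0, by simp, by simp, fun Q _ => coneInner_zero_left Q⟩
  add_mem' := by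
    rintro _ _ ⟨P, hP, rfl, hPo⟩ ⟨P', hP', rfl, hPo'⟩
    refine ⟨P + P', (MvPolynomial.totalDegree_add P P').trans (max_le hP hP'), map_add _ _ _,
      fun Q hQ => ?_⟩
    rw [coneInner_add_left hβ hγ, hPo Q hQ, hPo' Q hQ, add_zero]
  smul_mem' := by
    rintro c _ ⟨P, hP, rfl, hPo⟩
    refine ⟨c • P, (MvPolynomial.totalDegree_smul_le c P).trans hP, map_smul _ _ _,
      fun Q hQ => ?_⟩
    rw [coneInner_smul_left, hPo Q hQ, mul_zero]

/-- The space `V_n^d(w_{β,-s})` (`β > -d-s`) of Sobolev orthogonal polynomials of degree `n` on the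
conic surface.

The derivative `∂_t` with `x` fixed is not well defined modulo `t^2 - ‖x‖^2`, so a polynomial on
the cone is represented by its unique representative `∑ p_i(t) Y_i(x)`, `Y_i` solid harmonics,
i.e. by the unique polynomial in `(x,t)` with the same restriction to the cone that is harmonic in
`x`; this representative also realizes the degree of the polynomial on the cone.
`V_n^d(w_{β,-s})` consists of the polynomials on the cone of degree at most `n` that are
orthogonal to all polynomials on the cone of degree less than `n` for `⟨·,·⟩_{β,-s}`. -/
def sobolevOrthPoly (d : ℕ) (β : ℝ) (s : ℕ) (hβ : -(d : ℝ) - s < β) (lam : ℕ → ℝ) (n : ℕ) :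
    Submodule ℝ (cone d → ℝ) where
  carrier := {f | ∃ P : Poly d, laplacianX d P = 0 ∧ P.totalDegree ≤ n ∧ restrict d P = f ∧
    ∀ Q : Poly d, laplacianX d Q = 0 → Q.totalDegree < n → sobolevInner d β s lam P Q = 0}
  zero_mem' := ⟨0, by simp, by simp, by simp, fun Q _ _ => sobolevInner_zero_left lam Q⟩
  add_mem' := by
    rintro _ _ ⟨P, hPh, hP, rfl, hPo⟩ ⟨P', hPh', hP', rfl, hPo'⟩
    refine ⟨P + P', by rw [map_add, hPh, hPh', add_zero],
      (MvPolynomial.totalDegree_add P P').trans (max_le hP hP'), map_add _ _ _,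
      fun Q hQh hQ => ?_⟩
    rw [sobolevInner_add_left hβ, hPo Q hQh hQ, hPo' Q hQh hQ, add_zero]
  smul_mem' := by
    rintro c _ ⟨P, hPh, hP, rfl, hPo⟩
    refine ⟨c • P, by rw [map_smul, hPh, smul_zero],
      (MvPolynomial.totalDegree_smul_le c P).trans hP, map_smul _ _ _, fun Q hQh hQ => ?_⟩
    rw [sobolevInner_smul_left, hPo Q hQh hQ, mul_zero]

/-- `V_k^d(w_{β,γ})` for an integer index `k`: it is `{0}` for `k < 0`. -/
def orthPolyInt (d : ℕ) (β γ : ℝ) (hβ : -(d : ℝ) < β) (hγ : -1 < γ) (k : ℤ) :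
    Submodule ℝ (cone d → ℝ) :=
  if 0 ≤ k then orthPoly d β γ hβ hγ k.toNat else ⊥

/-- `H_k^{d,0}` for an integer index `k`, as a space of functions `(x,t) ↦ Y(x)` on the cone:
it is `{0}` for `k < 0`. -/
def harmonicsOnCone (d : ℕ) (k : ℤ) : Submodule ℝ (cone d → ℝ) :=
  if 0 ≤ k then
    (solidHarmonics d k.toNat).map
      (restrict d ∘ₗ (MvPolynomial.rename (R := ℝ) (some : Fin d → Option (Fin d))).toLinearMap)
  else ⊥

/-- The space `(1-t)^j W` for a space `W` of functions on the cone. -/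
def oneSubTPowMul (d j : ℕ) (W : Submodule ℝ (cone d → ℝ)) : Submodule ℝ (cone d → ℝ) :=
  W.map (LinearMap.mulLeft ℝ (fun p : cone d => (1 - p.1.2) ^ j))

/-! ### The two families of polynomials -/

/-- The Jacobi polynomials on the cone,
`S_m^{n,(β,γ)}(x,t) = P_{n-m}^{(2m+β+d-1,γ)}(1-2t) Y(x)` with `Y` a solid harmonic of degree `m`
and `m ≤ n`. -/
def coneS (d : ℕ) (β γ : ℝ) (n m : ℕ) (Y : MvPolynomial (Fin d) ℝ)
    (x : EuclideanSpace ℝ (Fin d)) (t : ℝ) : ℝ :=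
  jacobiP (2 * m + β + d - 1) γ (n - m) (1 - 2 * t) * evalX Y x

/-- The Sobolev polynomials on the cone,
`S_m^{n,(β,-s)}(x,t) = J_{n-m}^{(2m+β+d-1,-s)}(1-2t) Y(x)` with `Y` a solid harmonic of degree `m`
and `m ≤ n`. -/
def sobolevS (d : ℕ) (β : ℝ) (s n m : ℕ) (Y : MvPolynomial (Fin d) ℝ)
    (x : EuclideanSpace ℝ (Fin d)) (t : ℝ) : ℝ :=
  jacobiJ (2 * m + β + d - 1 + s) 0 s (n - m) (1 - 2 * t) * evalX Y x

/-- The constant `b_{m,n}^s = (-1)^s 2^s A_{n-s-m}^{(2m+β+d-1,s)} / (-(n-m))_s`, for `m + s ≤ n`. -/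
def bConst (d : ℕ) (β : ℝ) (s n m : ℕ) : ℝ :=
  (-1) ^ s * 2 ^ s * jacobiA (2 * m + β + d - 1) s (n - s - m) / poch (-((n : ℝ) - m)) s

end ConeSobolev

end

open ConeSobolev

/-!
The first identity says that `(1 + u)^s P_n^{(a,s)}(u)` is, up to a constant, the `s`-fold
antiderivative of `P_n^{(a+s,0)}` from `-1`. It comes from iterating
`((1 + u)^{j+1} P_n^{(a,j+1)})' = (n + j + 1) (1 + u)^j P_n^{(a+1,j)}`.

For the decomposition, write a polynomial on the cone as `∑ p_i(t) Y_i(x)` with solid harmonics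
`Y_i` that are orthogonal on the sphere: this is Fischer's decomposition in powers of `‖x‖²`,
combined with `‖x‖² = t²`. Both inner products are diagonal in these coordinates. On the
coefficients of a `Y_i` of degree `m`, and with `α = 2m + β + d - 1`, they are constant multiples of
`∫ p q t^α (1 - t)^s dt` and `∫ p⁽ˢ⁾ q⁽ˢ⁾ t^{α+s} dt + ∑_k λ_k p⁽ᵏ⁾(1) q⁽ᵏ⁾(1)`.

Let `p` have degree at most `N` and be orthogonal to the polynomials of degree less than `N` for
the second form. Testing against `(t - 1)^k` for `k < min(N, s)` shows that `p` vanishes at `1` to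
order `min(N, s)`. If `N < s`, then `p` is a multiple of `(1 - t)^N`. If `N ≥ s`, then
`p = (1 - t)^s r`, and `s` integrations by parts, which have no boundary terms, turn the Sobolev
orthogonality of `p` to `t^{i+s}` into the orthogonality of `r` to `t^i` for the first form.
-/

noncomputable section

namespace ConeSobolev

section Jacobi

open Polynomial

lemma poch_zero (a : ℝ) : poch a 0 = 1 := by simp [poch]

lemma poch_succ_right (a : ℝ) (n : ℕ) : poch a (n + 1) = poch a n * (a + n) :=
  ascPochhammer_succ_eval n a

lemma poch_succ_left (a : ℝ) (n : ℕ) : poch a (n + 1) = a * poch (a + 1) n := by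
  simp [poch, ascPochhammer_succ_left, eval_comp]

lemma poch_pos {a : ℝ} (ha : 0 < a) (n : ℕ) : 0 < poch a n :=
  ascPochhammer_pos n a ha

lemma poch_neg_add_natCast (a : ℝ) (n : ℕ) :
    poch (-(a + n)) n = (-1) ^ n * poch (a + 1) n := by
  induction n with
  | zero => simp [poch_zero]
  | succ n ih =>
    rw [poch_succ_left, poch_succ_right, show -(a + (n + 1 : ℕ)) + 1 = -(a + n) by push_cast; ring,
      ih]
    push_cast
    ring

/-- The coefficients of `n! P_n^{(α,β)}` in powers of `(x - 1) / 2`. -/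
def jacobiCoeff (α β : ℝ) (n k : ℕ) : ℝ :=
  n.choose k * poch (n + α + β + 1) k * poch (α + k + 1) (n - k)

/-- The polynomial `n! P_n^{(α,β)}(1 + 2z)` in the variable `z = (x - 1) / 2`. -/
def shiftedJacobi (α β : ℝ) (n : ℕ) : ℝ[X] :=
  ∑ k ∈ Finset.range (n + 1), monomial k (jacobiCoeff α β n k)

/-- The Jacobi polynomial `P_n^{(α,β)}` as an element of `ℝ[X]`. -/
def jacobiPoly (α β : ℝ) (n : ℕ) : ℝ[X] :=
  C (1 / (n.factorial : ℝ)) * (shiftedJacobi α β n).comp (C (1 / 2) * (X - 1))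

lemma eval_jacobiPoly (α β : ℝ) (n : ℕ) (x : ℝ) :
    (jacobiPoly α β n).eval x = jacobiP α β n x := by
  simp only [jacobiPoly, shiftedJacobi, jacobiCoeff, jacobiP, eval_mul, eval_C, eval_comp, eval_sub,
    eval_X, eval_one, eval_finsetSum, eval_monomial, one_div_mul_eq_div]

lemma coeff_shiftedJacobi (α β : ℝ) (n k : ℕ) :
    (shiftedJacobi α β n).coeff k = jacobiCoeff α β n k := by
  simp only [shiftedJacobi, finsetSum_coeff, coeff_monomial, Finset.sum_ite_eq', Finset.mem_range,
    ite_eq_left_iff, not_lt]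
  intro hk
  simp [jacobiCoeff, Nat.choose_eq_zero_of_lt hk]

lemma jacobiCoeff_recurrence (α β : ℝ) (n k : ℕ) :
    (k + β) * jacobiCoeff α β n k + (k + 1) * jacobiCoeff α β n (k + 1) =
      (n + β) * jacobiCoeff (α + 1) (β - 1) n k := by
  have hparam : (n : ℝ) + (α + 1) + (β - 1) + 1 = n + α + β + 1 := by ring
  obtain hlt | rfl | ⟨j, rfl⟩ : n < k ∨ k = n ∨ ∃ j, n = k + (j + 1) := by
    obtain h | h | h := lt_trichotomy n k
    · exact .inl h
    · exact .inr (.inl h.symm)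
    · exact .inr (.inr ⟨n - k - 1, by omega⟩)
  · simp [jacobiCoeff, Nat.choose_eq_zero_of_lt hlt,
      Nat.choose_eq_zero_of_lt (hlt.trans_le k.le_succ)]
  · simp [jacobiCoeff, poch_zero, hparam]
  · have hchoose : ((k + (j + 1)).choose (k + 1) : ℝ) * (k + 1) =
        (k + (j + 1)).choose k * (j + 1) := by
      have := Nat.choose_succ_right_eq (k + (j + 1)) k
      rw [Nat.add_sub_cancel_left] at this
      exact_mod_cast this
    simp only [jacobiCoeff, hparam, show k + (j + 1) - k = j + 1 by omega,
      show k + (j + 1) - (k + 1) = j by omega]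
    rw [poch_succ_left (α + k + 1) j, poch_succ_right (α + 1 + k + 1) j, poch_succ_right _ k,
      show α + (k + 1 : ℕ) + 1 = α + k + 1 + 1 by push_cast; ring,
      show α + 1 + k + 1 = α + k + 1 + 1 by ring]
    push_cast
    linear_combination (poch (k + (j + 1) + α + β + 1) k * (k + (j + 1) + α + β + 1 + k) *
      poch (α + k + 1 + 1) j) * hchoose

lemma shiftedJacobi_relation (α β : ℝ) (n : ℕ) :
    (1 + X) * derivative (shiftedJacobi α β n) + C β * shiftedJacobi α β n =
      C (n + β) * shiftedJacobi (α + 1) (β - 1) n := by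
  ext k
  have hrec := jacobiCoeff_recurrence α β n k
  cases k with
  | zero =>
    simp only [add_mul, one_mul, coeff_add, coeff_X_mul_zero, coeff_C_mul, coeff_derivative,
      coeff_shiftedJacobi] at hrec ⊢
    push_cast at hrec ⊢
    linear_combination hrec
  | succ k =>
    simp only [add_mul, one_mul, coeff_add, coeff_X_mul, coeff_C_mul, coeff_derivative,
      coeff_shiftedJacobi] at hrec ⊢
    push_cast at hrec ⊢
    linear_combination hrec

lemma jacobiPoly_relation (α β : ℝ) (n : ℕ) :
    (1 + X) * derivative (jacobiPoly α β n) + C β * jacobiPoly α β n =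
      C (n + β) * jacobiPoly (α + 1) (β - 1) n := by
  have h := congrArg (fun p => p.comp (C (1 / 2 : ℝ) * (X - 1))) (shiftedJacobi_relation α β n)
  have hhalf : (1 : ℝ[X]) + C (1 / 2) * (X - 1) = C (1 / 2) * (1 + X) := by
    have : C (1 / 2 : ℝ) * 2 = 1 := by rw [← C_ofNat, ← C_mul]; norm_num
    linear_combination (-1 : ℝ[X]) * this
  simp only [add_comp, mul_comp, X_comp, one_comp, C_comp, hhalf] at h
  simp only [jacobiPoly, derivative_mul, derivative_comp, derivative_C, derivative_sub,
    derivative_X, derivative_one]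
  linear_combination C (1 / (n.factorial : ℝ)) * h

lemma derivative_one_add_X_pow_mul_jacobiPoly (α : ℝ) (j n : ℕ) :
    derivative ((1 + X) ^ (j + 1) * jacobiPoly α (j + 1 : ℕ) n) =
      C (n + j + 1 : ℝ) * ((1 + X) ^ j * jacobiPoly (α + 1) j n) := by
  have h := jacobiPoly_relation α (j + 1 : ℕ) n
  rw [show ((j + 1 : ℕ) : ℝ) - 1 = j by push_cast; ring] at h
  simp only [derivative_mul, derivative_pow, derivative_add, derivative_one, derivative_X,
    Nat.add_sub_cancel]
  simp only [Nat.cast_add, Nat.cast_one, ← add_assoc] at h ⊢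
  linear_combination (1 + X) ^ j * h

lemma iterate_derivative_one_add_X_pow_mul_jacobiPoly (α : ℝ) (j n k : ℕ) :
    derivative^[k] ((1 + X) ^ (j + k) * jacobiPoly α (j + k : ℕ) n) =
      C (poch (n + j + 1) k) * ((1 + X) ^ j * jacobiPoly (α + k) j n) := by
  induction k generalizing j with
  | zero => simp [poch_zero]
  | succ k ih =>
    have h := ih (j + 1)
    rw [show j + 1 + k = j + (k + 1) by omega] at h
    rw [Function.iterate_succ_apply', h, derivative_C_mul,
      derivative_one_add_X_pow_mul_jacobiPoly, poch_succ_left,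
      show α + (k + 1 : ℕ) = α + k + 1 by push_cast; ring,
      show (n : ℝ) + (j + 1 : ℕ) + 1 = n + j + 1 + 1 by push_cast; ring, C_mul]
    ring

lemma integral_sub_pow_mul_iterate_derivative (f : ℝ[X]) {a : ℝ} {s : ℕ}
    (hf : ∀ k ≤ s, (derivative^[k] f).eval a = 0) (x : ℝ) :
    ∫ v in a..x, (x - v) ^ s / (s.factorial : ℝ) * (derivative^[s + 1] f).eval v = f.eval x := by
  induction s with
  | zero =>
    have h := intervalIntegral.integral_eq_sub_of_hasDerivAt (a := a) (b := x)
      (fun v _ => f.hasDerivAt v) (f.derivative.continuous.intervalIntegrable _ _)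
    simpa [show f.eval a = 0 from hf 0 le_rfl] using h
  | succ s ih =>
    have hpow (v : ℝ) : HasDerivAt (fun v : ℝ => (x - v) ^ (s + 1) / ((s + 1).factorial : ℝ))
        (-((x - v) ^ s / (s.factorial : ℝ))) v := by
      refine ((((hasDerivAt_id v).const_sub x).fun_pow (s + 1)).div_const _).congr_deriv ?_
      rw [Nat.factorial_succ]
      push_cast
      simp only [id]
      field_simp
    have hder (v : ℝ) := (derivative^[s + 1] f).hasDerivAt v
    have hparts := intervalIntegral.integral_mul_deriv_eq_deriv_mul (a := a) (b := x)
      (fun v _ => hpow v) (fun v _ => hder v)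
      (Continuous.intervalIntegrable (by fun_prop) _ _)
      ((derivative _).continuous.intervalIntegrable _ _)
    rw [Function.iterate_succ_apply', hparts, hf (s + 1) le_rfl]
    simp only [sub_self, zero_pow s.succ_ne_zero, zero_div, zero_mul, mul_zero, neg_mul,
      intervalIntegral.integral_neg, zero_sub, neg_neg, ih fun k hk => hf k (hk.trans s.le_succ)]

lemma integral_sub_pow_mul_jacobiP (α : ℝ) (s n : ℕ) (x : ℝ) :
    ∫ v in (-1 : ℝ)..x, (x - v) ^ s / (s.factorial : ℝ) * jacobiP (α + (s + 1 : ℕ)) 0 n v =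
      (1 + x) ^ (s + 1) * jacobiP α (s + 1 : ℕ) n x / poch (n + 1) (s + 1) := by
  have hpoch : poch (n + 1) (s + 1) ≠ 0 := (poch_pos (by positivity) _).ne'
  have hvanish (k : ℕ) (hk : k ≤ s) :
      (derivative^[k] ((1 + X) ^ (s + 1) * jacobiPoly α (s + 1 : ℕ) n)).eval (-1) = 0 := by
    obtain ⟨j, hj⟩ : ∃ j, s + 1 = j + 1 + k := ⟨s - k, by omega⟩
    rw [hj, iterate_derivative_one_add_X_pow_mul_jacobiPoly]
    simp
  have hderiv := iterate_derivative_one_add_X_pow_mul_jacobiPoly α 0 n (s + 1)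
  have h := integral_sub_pow_mul_iterate_derivative _ hvanish x
  simp only [zero_add, pow_zero, one_mul, Nat.cast_zero, add_zero] at hderiv
  simp only [hderiv, eval_mul, eval_C, eval_pow, eval_add, eval_one, eval_X, eval_jacobiPoly,
    mul_left_comm _ (poch _ _), intervalIntegral.integral_const_mul] at h
  rw [eq_div_iff hpoch, mul_comm, h]

lemma jacobiJ_eq (a : ℝ) {s N : ℕ} (hs : 1 ≤ s) (hN : s ≤ N) (t : ℝ) :
    jacobiJ (a + s) 0 s N (1 - 2 * t) =
      (-1) ^ s * 2 ^ s * jacobiA a s (N - s) / poch (-(N : ℝ)) s * (1 - t) ^ s *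
        jacobiP a s (N - s) (1 - 2 * t) := by
  obtain ⟨k, rfl⟩ : ∃ k, N = k + s := ⟨N - s, by omega⟩
  obtain ⟨r, rfl⟩ : ∃ r, s = r + 1 := ⟨s - 1, by omega⟩
  have hA : jacobiA (a + (r + 1 : ℕ)) 0 k = jacobiA a (r + 1 : ℕ) k := by
    simp only [jacobiA]; congr 2; ring
  have hsign : ((-1 : ℝ) ^ (r + 1)) ≠ 0 := by simp
  simp only [jacobiJ, if_neg (show ¬k + (r + 1) < r + 1 by omega), Nat.add_sub_cancel, jacobiHat,
    hA, mul_left_comm _ (jacobiA _ _ _), intervalIntegral.integral_const_mul,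
    integral_sub_pow_mul_jacobiP, show 1 + (1 - 2 * t) = 2 * (1 - t) by ring, mul_pow]
  rw [Nat.cast_add k, poch_neg_add_natCast]
  field_simp

lemma sobolevS_eq_coneS (d : ℕ) (β : ℝ) {s n m : ℕ} (hs : 1 ≤ s) (hmn : m ≤ n) (h : s ≤ n - m)
    (y : MvPolynomial (Fin d) ℝ) (x : EuclideanSpace ℝ (Fin d)) (t : ℝ) :
    sobolevS d β s n m y x t =
      bConst d β s n m * (1 - t) ^ s * coneS d β s (n - s) m y x t := by
  rw [sobolevS, coneS, bConst, jacobiJ_eq _ hs h, ← Nat.cast_sub hmn, Nat.sub_right_comm n s m]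
  ring

lemma sobolevS_of_lt (d : ℕ) (β : ℝ) {s n m : ℕ} (h : n - m < s)
    (y : MvPolynomial (Fin d) ℝ) (x : EuclideanSpace ℝ (Fin d)) (t : ℝ) :
    sobolevS d β s n m y x t =
      2 ^ (n - m) / ((n - m).factorial : ℝ) * (1 - t) ^ (n - m) * evalX y x := by
  rw [sobolevS, jacobiJ, if_pos h, show 1 - 2 * t + 1 = 2 * (1 - t) by ring, mul_pow]
  ring

end Jacobi

section Fischer

open MvPolynomial

variable {d : ℕ}

lemma laplacian_apply (p : MvPolynomial (Fin d) ℝ) :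
    laplacian d p = ∑ i, pderiv i (pderiv i p) := by
  simp [laplacian]

/-- The polynomial `‖x‖² = x_1² + ⋯ + x_d²`. -/
def normSq (d : ℕ) : MvPolynomial (Fin d) ℝ := ∑ i, X i ^ 2

lemma isHomogeneous_normSq : (normSq d).IsHomogeneous 2 :=
  IsHomogeneous.sum _ _ _ fun i _ => isHomogeneous_X_pow i 2

lemma pderiv_normSq (i : Fin d) : pderiv i (normSq d) = C 2 * X i := by
  classical
  simp [normSq, pderiv_X, Pi.single_apply, map_ofNat C 2]

lemma normSq_ne_zero [NeZero d] : normSq d ≠ 0 := by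
  intro h
  have := congrArg (eval fun _ => (1 : ℝ)) h
  simp [normSq, NeZero.ne d] at this

lemma coeff_laplacian (p : MvPolynomial (Fin d) ℝ) (e : Fin d →₀ ℕ) :
    coeff e (laplacian d p) = ∑ i, coeff (e + Finsupp.single i 1 + Finsupp.single i 1) p *
      (((e + Finsupp.single i 1 : Fin d →₀ ℕ) i : ℝ) + 1) * (e i + 1) := by
  rw [laplacian_apply, coeff_sum]
  exact Finset.sum_congr rfl fun i _ => by rw [coeff_pderiv, coeff_pderiv]

lemma isHomogeneous_laplacian {p : MvPolynomial (Fin d) ℝ} {k : ℕ} (hp : p.IsHomogeneous k) :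
    (laplacian d p).IsHomogeneous (k - 2) := by
  rw [laplacian_apply]
  exact IsHomogeneous.sum _ _ _ fun i _ => hp.pderiv.pderiv

lemma laplacian_eq_zero_of_isHomogeneous_of_lt {p : MvPolynomial (Fin d) ℝ} {k : ℕ}
    (hp : p.IsHomogeneous k) (hk : k < 2) : laplacian d p = 0 := by
  ext e
  rw [coeff_laplacian, coeff_zero]
  refine Finset.sum_eq_zero fun i _ => ?_
  rw [hp.coeff_eq_zero (by simp only [map_add, Finsupp.degree_single]; omega), zero_mul, zero_mul]

lemma laplacian_homogeneousComponent (p : MvPolynomial (Fin d) ℝ) (k : ℕ) :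
    laplacian d (homogeneousComponent (k + 2) p) = homogeneousComponent k (laplacian d p) := by
  ext e
  simp only [coeff_laplacian, coeff_homogeneousComponent, map_add, Finsupp.degree_single,
    add_assoc, Nat.reduceAdd, Nat.add_right_cancel_iff]
  split_ifs
  · rfl
  · simp

lemma homogeneousComponent_mem_solidHarmonics {p : MvPolynomial (Fin d) ℝ}
    (hp : laplacian d p = 0) (k : ℕ) : homogeneousComponent k p ∈ solidHarmonics d k := by
  have hhom := homogeneousComponent_isHomogeneous k p
  refine ⟨hhom, LinearMap.mem_ker.mpr ?_⟩
  obtain hk | ⟨j, rfl⟩ : k < 2 ∨ ∃ j, k = j + 2 := by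
    obtain hk | hk := lt_or_ge k 2
    · exact .inl hk
    · exact .inr ⟨k - 2, by omega⟩
  · exact laplacian_eq_zero_of_isHomogeneous_of_lt hhom hk
  · rw [laplacian_homogeneousComponent, hp, map_zero]

lemma laplacian_normSq_mul {g : MvPolynomial (Fin d) ℝ} {k : ℕ} (hg : g.IsHomogeneous k) :
    laplacian d (normSq d * g) = C (2 * d + 4 * k : ℝ) * g + normSq d * laplacian d g := by
  have hsecond (i : Fin d) : pderiv i (pderiv i (normSq d * g)) =
      C 2 * g + C 4 * (X i * pderiv i g) + normSq d * pderiv i (pderiv i g) := by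
    have h4 : (C 4 : MvPolynomial (Fin d) ℝ) = C 2 + C 2 := by rw [← C_add]; norm_num
    simp only [pderiv_mul, pderiv_normSq, map_add, pderiv_X_self, pderiv_C]
    linear_combination (-(X i * pderiv i g)) * h4
  simp only [laplacian_apply, hsecond, Finset.sum_add_distrib, ← Finset.mul_sum,
    hg.sum_X_mul_pderiv, Finset.sum_const, Finset.card_univ, Fintype.card_fin, nsmul_eq_mul,
    map_add, map_mul, map_ofNat, map_natCast]
  ring

lemma laplacian_normSq_pow_mul {g : MvPolynomial (Fin d) ℝ} {k : ℕ} (hg : g.IsHomogeneous k)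
    (j : ℕ) :
    laplacian d (normSq d ^ (j + 1) * g) =
      C (2 * (j + 1) * (d + 2 * j + 2 * k) : ℝ) * (normSq d ^ j * g) +
        normSq d ^ (j + 1) * laplacian d g := by
  induction j with
  | zero =>
    simp only [zero_add, pow_one, pow_zero, one_mul, laplacian_normSq_mul hg]
    congr 3
    push_cast
    ring
  | succ j ih =>
    have hhom : (normSq d ^ (j + 1) * g).IsHomogeneous (2 * (j + 1) + k) :=
      (isHomogeneous_normSq.pow (j + 1)).mul hg
    rw [pow_succ', mul_assoc, laplacian_normSq_mul hhom, ih]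
    simp only [map_add, map_mul, map_ofNat, map_natCast, map_one]
    push_cast
    ring

lemma exists_normSq_mul_laplacian_eq_smul [NeZero d] {g : MvPolynomial (Fin d) ℝ} {k j : ℕ}
    (hg : g.IsHomogeneous k) (h : laplacian d (normSq d ^ (j + 1) * g) = 0) :
    ∃ c : ℝ, c ≠ 0 ∧ normSq d * laplacian d g = c • g := by
  have hd : (0 : ℝ) < d := Nat.cast_pos.mpr (NeZero.pos d)
  refine ⟨-(2 * (j + 1) * (d + 2 * j + 2 * k) : ℝ), neg_ne_zero.mpr (by positivity), ?_⟩
  rw [laplacian_normSq_pow_mul hg, pow_succ, mul_assoc (normSq d ^ j), mul_left_comm, ← mul_add]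
    at h
  have hsum := (mul_eq_zero.mp h).resolve_left (pow_ne_zero j normSq_ne_zero)
  rw [← smul_eq_C_mul] at hsum
  rw [neg_smul, eq_neg_of_add_eq_zero_right hsum]

lemma eq_zero_of_laplacian_normSq_pow_mul_eq_zero [NeZero d] {g : MvPolynomial (Fin d) ℝ}
    {k j : ℕ} (hg : g.IsHomogeneous k) (h : laplacian d (normSq d ^ (j + 1) * g) = 0) :
    g = 0 := by
  induction k using Nat.strong_induction_on generalizing g j with
  | _ k ih =>
    obtain ⟨c, hc, hgc⟩ := exists_normSq_mul_laplacian_eq_smul hg h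
    have hlap : laplacian d g = 0 := by
      obtain hk | hk := lt_or_ge k 2
      · exact laplacian_eq_zero_of_isHomogeneous_of_lt hg hk
      · refine ih (k - 2) (by omega) (isHomogeneous_laplacian hg) (j := j + 1) ?_
        rw [pow_succ, mul_assoc, hgc, mul_smul_comm, map_smul, h, smul_zero]
    rw [hlap, mul_zero] at hgc
    exact (smul_eq_zero.mp hgc.symm).resolve_left hc

lemma exists_eq_add_normSq_mul [NeZero d] {m : ℕ} {p : MvPolynomial (Fin d) ℝ}
    (hp : p.IsHomogeneous (m + 2)) :
    ∃ h ∈ solidHarmonics d (m + 2), ∃ q : MvPolynomial (Fin d) ℝ, q.IsHomogeneous m ∧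
      p = h + normSq d * q := by
  have : FiniteDimensional ℝ (homogeneousSubmodule (Fin d) ℝ m) :=
    Module.Finite.iff_fg.mpr (homogeneousSubmodule_fg _ _ m)
  have hmaps : ∀ q ∈ homogeneousSubmodule (Fin d) ℝ m,
      (laplacian d ∘ₗ LinearMap.mulLeft ℝ (normSq d)) q ∈ homogeneousSubmodule (Fin d) ℝ m :=
    fun q hq => by
      have := isHomogeneous_laplacian (isHomogeneous_normSq.mul hq)
      rwa [Nat.add_sub_cancel_left] at this
  have hinj : Function.Injective (LinearMap.restrict _ hmaps) := by
    rw [← LinearMap.ker_eq_bot, LinearMap.ker_eq_bot']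
    rintro ⟨q, hq⟩ h
    have hlap : laplacian d (normSq d ^ (0 + 1) * q) = 0 := by
      simpa using congrArg Subtype.val h
    exact Subtype.ext (eq_zero_of_laplacian_normSq_pow_mul_eq_zero hq hlap)
  obtain ⟨⟨q, hq⟩, hqp⟩ := LinearMap.injective_iff_surjective.mp hinj
    ⟨laplacian d p, isHomogeneous_laplacian hp⟩
  have hlap : laplacian d (normSq d * q) = laplacian d p := congrArg Subtype.val hqp
  refine ⟨p - normSq d * q, ⟨hp.sub ?_, ?_⟩, q, hq, (sub_add_cancel _ _).symm⟩
  · rw [add_comm]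
    exact isHomogeneous_normSq.mul hq
  · simp [hlap]

end Fischer

section Gaussian

open MvPolynomial

variable {d : ℕ}

@[simp] lemma evalX_add (p q : MvPolynomial (Fin d) ℝ) (x : EuclideanSpace ℝ (Fin d)) :
    evalX (p + q) x = evalX p x + evalX q x := by simp [evalX]

@[simp] lemma evalX_smul (c : ℝ) (p : MvPolynomial (Fin d) ℝ) (x : EuclideanSpace ℝ (Fin d)) :
    evalX (c • p) x = c * evalX p x := by simp [evalX]

@[simp] lemma evalX_mul (p q : MvPolynomial (Fin d) ℝ) (x : EuclideanSpace ℝ (Fin d)) :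
    evalX (p * q) x = evalX p x * evalX q x := by simp [evalX]

@[simp] lemma evalX_X (i : Fin d) (x : EuclideanSpace ℝ (Fin d)) :
    evalX (X i) x = x i := by simp [evalX]

lemma continuous_evalX (p : MvPolynomial (Fin d) ℝ) : Continuous (evalX p) :=
  (continuous_eval p).comp (by fun_prop)

lemma evalX_smul_of_isHomogeneous {p : MvPolynomial (Fin d) ℝ} {k : ℕ} (hp : p.IsHomogeneous k)
    (t : ℝ) (x : EuclideanSpace ℝ (Fin d)) : evalX p (t • x) = t ^ k * evalX p x := by
  simp only [evalX, eval_eq, Finset.mul_sum]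
  refine Finset.sum_congr rfl fun m hm => ?_
  have hk : ∑ i ∈ m.support, m i = k := by
    by_contra hne
    exact mem_support_iff.mp hm (hp.coeff_eq_zero hne)
  simp only [PiLp.smul_apply, smul_eq_mul, mul_pow, Finset.prod_mul_distrib,
    Finset.prod_pow_eq_pow_sum, hk]
  ring

lemma hasLineDerivAt_evalX (p : MvPolynomial (Fin d) ℝ) (i : Fin d)
    (x : EuclideanSpace ℝ (Fin d)) :
    HasLineDerivAt ℝ (evalX p) (evalX (pderiv i p) x) x (EuclideanSpace.single i 1) := by
  classical
  induction p using MvPolynomial.induction_on with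
  | C a => simpa [HasLineDerivAt, evalX] using hasDerivAt_const (0 : ℝ) a
  | add p q hp hq => simpa [HasLineDerivAt] using HasDerivAt.fun_add hp hq
  | mul_X p j hp =>
    have hj : HasDerivAt (fun t : ℝ => (x + t • EuclideanSpace.single i (1 : ℝ)) j)
        (Pi.single (M := fun _ => ℝ) i 1 j) 0 := by
      simp only [PiLp.add_apply, PiLp.smul_apply, PiLp.single_apply, Pi.single_apply,
        smul_eq_mul]
      simpa using ((hasDerivAt_id (0 : ℝ)).mul_const (if j = i then (1 : ℝ) else 0)).const_add (x j)
    simp only [HasLineDerivAt, evalX_mul, evalX_X]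
    refine (HasDerivAt.fun_mul hp hj).congr_deriv ?_
    simp only [zero_smul, add_zero, pderiv_mul, evalX_add, evalX_mul, evalX_X, pderiv_X,
      Pi.single_apply]
    split_ifs <;> simp [evalX]

lemma hasLineDerivAt_gaussian (i : Fin d) (x : EuclideanSpace ℝ (Fin d)) :
    HasLineDerivAt ℝ (fun y : EuclideanSpace ℝ (Fin d) => Real.exp (-‖y‖ ^ 2))
      (-(2 * x i * Real.exp (-‖x‖ ^ 2))) x (EuclideanSpace.single i 1) := by
  have hn : ∀ t : ℝ, ‖x + t • EuclideanSpace.single i (1 : ℝ)‖ ^ 2 =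
      ‖x‖ ^ 2 + 2 * t * x i + t ^ 2 := fun t => by
    rw [norm_add_sq_real, inner_smul_right, norm_smul, EuclideanSpace.inner_single_right]
    simp only [PiLp.norm_single, conj_trivial, one_mul, norm_one, mul_one,
      Real.norm_eq_abs, sq_abs]
    ring
  simp only [HasLineDerivAt, hn]
  have hlin : HasDerivAt (fun t : ℝ => 2 * t * x i) (2 * 1 * x i) 0 :=
    ((hasDerivAt_id (0 : ℝ)).const_mul 2).mul_const (x i)
  have hsq := ((hlin.const_add (‖x‖ ^ 2)).add (hasDerivAt_pow 2 (0 : ℝ))).neg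
  exact hsq.exp.congr_deriv (by simp; ring)

lemma integrable_prod_pow_mul_gaussian (m : Fin d → ℕ) :
    Integrable fun x : EuclideanSpace ℝ (Fin d) => (∏ i, x i ^ m i) * Real.exp (-‖x‖ ^ 2) := by
  have h := (PiLp.volume_preserving_ofLp (Fin d)).integrable_comp_of_integrable
    (Integrable.fintype_prod (μ := fun _ : Fin d => volume)
      (f := fun i (r : ℝ) => r ^ m i * Real.exp (-r ^ 2)) fun i => by
        simpa using integrable_rpow_mul_exp_neg_mul_sq one_pos (s := m i)
          (by linarith [(m i).cast_nonneg (α := ℝ)]))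
  refine h.congr (Filter.Eventually.of_forall fun x => ?_)
  simp only [Function.comp_apply, Finset.prod_mul_distrib, ← Real.exp_sum, Finset.sum_neg_distrib,
    EuclideanSpace.real_norm_sq_eq]

lemma integrable_evalX_mul_gaussian (p : MvPolynomial (Fin d) ℝ) :
    Integrable fun x : EuclideanSpace ℝ (Fin d) => evalX p x * Real.exp (-‖x‖ ^ 2) := by
  simp only [evalX, eval_eq', Finset.sum_mul, mul_assoc]
  exact integrable_finsetSum _ fun m _ => (integrable_prod_pow_mul_gaussian m).const_mul _

/-- The integral of a polynomial against the Gaussian `exp (-‖x‖²)`. -/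
def gaussianIntegral (d : ℕ) : MvPolynomial (Fin d) ℝ →ₗ[ℝ] ℝ where
  toFun p := ∫ x : EuclideanSpace ℝ (Fin d), evalX p x * Real.exp (-‖x‖ ^ 2)
  map_add' p q := by
    simp only [evalX_add, add_mul]
    exact integral_add (integrable_evalX_mul_gaussian p) (integrable_evalX_mul_gaussian q)
  map_smul' c p := by
    simp only [evalX_smul, mul_assoc, integral_const_mul, RingHom.id_apply, smul_eq_mul]

lemma gaussianIntegral_apply (p : MvPolynomial (Fin d) ℝ) :
    gaussianIntegral d p =
      ∫ x : EuclideanSpace ℝ (Fin d), evalX p x * Real.exp (-‖x‖ ^ 2) := rfl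

lemma gaussianIntegral_pderiv (i : Fin d) (p : MvPolynomial (Fin d) ℝ) :
    gaussianIntegral d (pderiv i p) = 2 * gaussianIntegral d (X i * p) := by
  have hXp : (fun x : EuclideanSpace ℝ (Fin d) => evalX p x * -(2 * x i * Real.exp (-‖x‖ ^ 2))) =
      fun x => -2 * (evalX (X i * p) x * Real.exp (-‖x‖ ^ 2)) := by
    ext x
    rw [evalX_mul, evalX_X]
    ring
  have h := integral_bilinear_hasLineDerivAt_right_eq_neg_left_of_integrable
    (μ := (volume : Measure (EuclideanSpace ℝ (Fin d)))) (B := ContinuousLinearMap.mul ℝ ℝ)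
    (integrable_evalX_mul_gaussian (pderiv i p))
    (show Integrable fun x : EuclideanSpace ℝ (Fin d) =>
        evalX p x * -(2 * x i * Real.exp (-‖x‖ ^ 2)) from
      hXp ▸ (integrable_evalX_mul_gaussian (X i * p)).const_mul _)
    (integrable_evalX_mul_gaussian p)
    (fun x _ => hasLineDerivAt_evalX p i x) (fun x _ => hasLineDerivAt_gaussian i x)
  simp only [ContinuousLinearMap.mul_apply', hXp, integral_const_mul,
    ← gaussianIntegral_apply] at h
  linarith

lemma gaussianIntegral_gradient (p : MvPolynomial (Fin d) ℝ) {q : MvPolynomial (Fin d) ℝ} {k : ℕ}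
    (hq : q ∈ solidHarmonics d k) :
    gaussianIntegral d (∑ i, pderiv i p * pderiv i q) = 2 * k * gaussianIntegral d (p * q) := by
  have hΔ : ∑ i, pderiv i (pderiv i q) = 0 := by
    rw [← laplacian_apply]
    exact hq.2
  have hdiv : ∑ i, pderiv i (p * pderiv i q) = ∑ i, pderiv i p * pderiv i q := by
    simp only [pderiv_mul, Finset.sum_add_distrib, ← Finset.mul_sum, hΔ, mul_zero, add_zero]
  have heuler : ∑ i, X i * (p * pderiv i q) = (k : ℝ) • (p * q) := by
    simp only [mul_left_comm _ p, ← Finset.mul_sum]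
    rw [IsHomogeneous.sum_X_mul_pderiv hq.1, mul_smul_comm, Nat.cast_smul_eq_nsmul]
  rw [← hdiv, map_sum]
  simp only [gaussianIntegral_pderiv]
  rw [← Finset.mul_sum, ← map_sum, heuler, map_smul, smul_eq_mul, mul_assoc]

lemma gaussianIntegral_mul_eq_zero {m k : ℕ} (hmk : m ≠ k) {p q : MvPolynomial (Fin d) ℝ}
    (hp : p ∈ solidHarmonics d m) (hq : q ∈ solidHarmonics d k) :
    gaussianIntegral d (p * q) = 0 := by
  have hk := gaussianIntegral_gradient p hq
  have hm := gaussianIntegral_gradient q hp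
  simp only [mul_comm (pderiv _ q), mul_comm q p] at hm
  refine (mul_eq_zero.mp (show ((m : ℝ) - k) * gaussianIntegral d (p * q) = 0 by linarith)
    ).resolve_left (sub_ne_zero.mpr (by exact_mod_cast hmk))

lemma integral_volumeIoiPow_pow_mul_exp_neg_sq (n k : ℕ) :
    ∫ r : Set.Ioi (0 : ℝ), (r : ℝ) ^ k * Real.exp (-(r : ℝ) ^ 2) ∂(Measure.volumeIoiPow n) =
      Real.Gamma ((n + k + 1) / 2) / 2 := by
  calc ∫ r : Set.Ioi (0 : ℝ), (r : ℝ) ^ k * Real.exp (-(r : ℝ) ^ 2) ∂(Measure.volumeIoiPow n)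
      = ∫ r in Set.Ioi (0 : ℝ), r ^ ((n + k : ℕ) : ℝ) * Real.exp (-r ^ (2 : ℝ)) := by
        simp only [Measure.volumeIoiPow, ENNReal.ofReal]
        rw [integral_withDensity_eq_integral_smul
            (measurable_subtype_coe.pow_const _).real_toNNReal,
          integral_subtype_comap measurableSet_Ioi fun a : ℝ =>
            Real.toNNReal (a ^ n) • (a ^ k * Real.exp (-a ^ 2))]
        refine setIntegral_congr_fun measurableSet_Ioi fun r (hr : 0 < r) => ?_
        simp only [NNReal.smul_def, Real.coe_toNNReal _ (pow_nonneg hr.le _), Real.rpow_natCast,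
          Real.rpow_ofNat, smul_eq_mul, pow_add, mul_assoc]
    _ = Real.Gamma ((n + k + 1) / 2) / 2 := by
        rw [integral_rpow_mul_exp_neg_rpow two_pos (by
          linarith [(n + k).cast_nonneg (α := ℝ)])]
        push_cast
        ring

lemma gaussianIntegral_eq_sphereIntegral [NeZero d] {p : MvPolynomial (Fin d) ℝ} {k : ℕ}
    (hp : p.IsHomogeneous k) :
    gaussianIntegral d p = sphereIntegral d (evalX p) * (Real.Gamma ((d + k) / 2) / 2) := by
  let E := EuclideanSpace ℝ (Fin d)
  have hpolar := (volume : Measure E).measurePreserving_homeomorphUnitSphereProd.integral_comp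
    (Homeomorph.measurableEmbedding _)
    (fun z => evalX p (z.1 : E) * ((z.2 : ℝ) ^ k * Real.exp (-(z.2 : ℝ) ^ 2)))
  rw [integral_prod_mul (fun ξ : Metric.sphere (0 : E) 1 => evalX p (ξ : E))
    (fun r : Set.Ioi (0 : ℝ) => (r : ℝ) ^ k * Real.exp (-(r : ℝ) ^ 2)),
    integral_volumeIoiPow_pow_mul_exp_neg_sq, finrank_euclideanSpace_fin,
    Nat.cast_pred (NeZero.pos d), add_right_comm, sub_add_cancel] at hpolar
  rw [gaussianIntegral_apply, ← restrict_compl_singleton (μ := (volume : Measure E)) 0,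
    ← integral_subtype_comap (measurableSet_singleton (0 : E)).compl
      (fun x : E => evalX p x * Real.exp (-‖x‖ ^ 2)), sphereIntegral, sphereMeasure, ← hpolar]
  refine integral_congr_ae (Filter.Eventually.of_forall fun x => ?_)
  have hx : ‖(x : E)‖ ≠ 0 := norm_ne_zero_iff.mpr x.2
  simp only [homeomorphUnitSphereProd_apply_fst_coe, homeomorphUnitSphereProd_apply_snd_coe,
    evalX_smul_of_isHomogeneous hp, inv_pow]
  field_simp

end Gaussian

section SphereInner

open MvPolynomial

variable {d : ℕ}

/-- The inner product of `L²` of the unit sphere, as a bilinear form on polynomials. -/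
def sphereInner (d : ℕ) : LinearMap.BilinForm ℝ (MvPolynomial (Fin d) ℝ) :=
  LinearMap.mk₂ ℝ (fun p q => sphereIntegral d fun ξ => evalX p ξ * evalX q ξ)
    (fun p p' q => by
      simp only [evalX_add, add_mul]
      exact sphereIntegral_add ((continuous_evalX p).mul (continuous_evalX q))
        ((continuous_evalX p').mul (continuous_evalX q)))
    (fun c p q => by simp only [evalX_smul, mul_assoc, sphereIntegral_const_mul, smul_eq_mul])
    (fun p q q' => by
      simp only [evalX_add, mul_add]
      exact sphereIntegral_add ((continuous_evalX p).mul (continuous_evalX q))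
        ((continuous_evalX p).mul (continuous_evalX q')))
    (fun c p q => by
      simp only [evalX_smul, mul_left_comm _ c, sphereIntegral_const_mul, smul_eq_mul])

lemma sphereInner_apply (p q : MvPolynomial (Fin d) ℝ) :
    sphereInner d p q = sphereIntegral d fun ξ => evalX p ξ * evalX q ξ := rfl

lemma sphereInner_comm (p q : MvPolynomial (Fin d) ℝ) : sphereInner d p q = sphereInner d q p := by
  simp only [sphereInner_apply, mul_comm]

lemma sphereInner_eq_zero_of_mem_solidHarmonics [NeZero d] {m k : ℕ} (hmk : m ≠ k)
    {p q : MvPolynomial (Fin d) ℝ} (hp : p ∈ solidHarmonics d m) (hq : q ∈ solidHarmonics d k) :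
    sphereInner d p q = 0 := by
  have h := gaussianIntegral_eq_sphereIntegral
    (IsHomogeneous.mul (show p.IsHomogeneous m from hp.1) (show q.IsHomogeneous k from hq.1))
  rw [gaussianIntegral_mul_eq_zero hmk hp hq, zero_eq_mul] at h
  have hΓ : Real.Gamma ((d + (m + k : ℕ)) / 2) / 2 ≠ 0 := by
    have : 0 < d := NeZero.pos d
    have := Real.Gamma_pos_of_pos (show (0 : ℝ) < (d + (m + k : ℕ)) / 2 by positivity)
    positivity
  simpa only [sphereInner_apply, ← evalX_mul] using h.resolve_right hΓ

lemma eq_zero_of_evalX_eq_zero_on_sphere [NeZero d] {p : MvPolynomial (Fin d) ℝ} {k : ℕ}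
    (hp : p.IsHomogeneous k)
    (h : ∀ ξ : Metric.sphere (0 : EuclideanSpace ℝ (Fin d)) 1, evalX p ξ = 0) : p = 0 := by
  have hcompl : ∀ x : EuclideanSpace ℝ (Fin d), x ≠ 0 → evalX p x = 0 := fun x hx => by
    have hx' : x = ‖x‖ • ‖x‖⁻¹ • x := (smul_inv_smul₀ (norm_ne_zero_iff.mpr hx) x).symm
    rw [hx', evalX_smul_of_isHomogeneous hp, h ⟨‖x‖⁻¹ • x, by simp [norm_smul, hx]⟩, mul_zero]
  have hdense : Dense ({0}ᶜ : Set (EuclideanSpace ℝ (Fin d))) := dense_compl_singleton 0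
  have hzero : evalX p = 0 :=
    (continuous_evalX p).ext_on hdense continuous_const fun x hx => hcompl x hx
  exact MvPolynomial.funext fun x =>
    (congrFun hzero (WithLp.toLp 2 x)).trans (map_zero (eval x)).symm

lemma sphereInner_self_ne_zero [NeZero d] {p : MvPolynomial (Fin d) ℝ} {k : ℕ}
    (hp : p.IsHomogeneous k) (hp0 : p ≠ 0) : sphereInner d p p ≠ 0 := by
  have : (sphereMeasure d).IsOpenPosMeasure := by
    unfold sphereMeasure
    infer_instance
  have hcont : Continuous fun ξ : Metric.sphere (0 : EuclideanSpace ℝ (Fin d)) 1 =>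
      evalX p ξ * evalX p ξ :=
    ((continuous_evalX p).mul (continuous_evalX p)).comp continuous_subtype_val
  contrapose! hp0
  rw [sphereInner_apply, sphereIntegral, integral_eq_zero_iff_of_nonneg
    (fun ξ => mul_self_nonneg _) (hcont.integrable_of_hasCompactSupport
      (HasCompactSupport.of_compactSpace _)), hcont.ae_eq_iff_eq _ continuous_zero] at hp0
  exact eq_zero_of_evalX_eq_zero_on_sphere hp fun ξ => mul_self_eq_zero.mp (congrFun hp0 ξ)

/-- A basis of the harmonic polynomials, indexed by `ι`, whose `i`-th member is homogeneous of
degree `deg i`, and which is orthogonal (not necessarily normalized) on the unit sphere. -/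
structure IsHarmonicBasis {ι : Type*} (deg : ι → ℕ) (Y : ι → MvPolynomial (Fin d) ℝ) : Prop where
  solidHarmonics_eq_span : ∀ m, solidHarmonics d m = Submodule.span ℝ (Y '' {i | deg i = m})
  sphereInner_eq_zero : ∀ i j, i ≠ j → sphereInner d (Y i) (Y j) = 0
  sphereInner_self_ne_zero : ∀ i, sphereInner d (Y i) (Y i) ≠ 0

lemma exists_isHarmonicBasis (d : ℕ) [NeZero d] :
    ∃ (ι : Type) (deg : ι → ℕ) (Y : ι → MvPolynomial (Fin d) ℝ), IsHarmonicBasis deg Y := by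
  have hfin : ∀ m, Module.Finite ℝ (solidHarmonics d m) := fun m =>
    Module.Finite.iff_fg.mpr ((homogeneousSubmodule_fg (Fin d) ℝ m).of_le inf_le_left)
  choose v hv using fun m => LinearMap.BilinForm.exists_orthogonal_basis
    (B := (sphereInner d).restrict (solidHarmonics d m))
    ⟨fun p q => sphereInner_comm (p : MvPolynomial (Fin d) ℝ) q⟩
  have hmem : ∀ i : Σ m, Fin (Module.finrank ℝ (solidHarmonics d m)),
      (v i.1 i.2 : MvPolynomial (Fin d) ℝ) ∈ solidHarmonics d i.1 := fun i => (v i.1 i.2).2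
  refine ⟨Σ m, Fin (Module.finrank ℝ (solidHarmonics d m)), Sigma.fst, fun i => v i.1 i.2,
    fun m => ?_, ?_, fun i => ?_⟩
  · rw [show (fun i : Σ m, Fin (Module.finrank ℝ (solidHarmonics d m)) =>
        (v i.1 i.2 : MvPolynomial (Fin d) ℝ)) '' {i | i.1 = m} =
        (solidHarmonics d m).subtype '' Set.range (v m) by
      ext p; constructor
      · rintro ⟨⟨_, l⟩, rfl, rfl⟩; exact ⟨_, ⟨l, rfl⟩, rfl⟩
      · rintro ⟨_, ⟨l, rfl⟩, rfl⟩; exact ⟨⟨m, l⟩, rfl, rfl⟩]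
    rw [← Submodule.map_span, (v m).span_eq, Submodule.map_subtype_top]
  · rintro ⟨m, l⟩ ⟨k, l'⟩ hij
    by_cases hmk : m = k
    · subst hmk
      exact hv m fun h => hij (congrArg (Sigma.mk m) h)
    · exact sphereInner_eq_zero_of_mem_solidHarmonics hmk (hmem ⟨m, l⟩) (hmem ⟨k, l'⟩)
  · exact sphereInner_self_ne_zero (hmem i).1 (by simpa using (v i.1).ne_zero i.2)

end SphereInner

section OneVariable

open Polynomial

/-- The functional `p ↦ ∫_0^1 t^α p(t) dt`, given by the moments `1 / (α + i + 1)`, so that it is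
linear for every real `α`. -/
def moment (α : ℝ) : ℝ[X] →ₗ[ℝ] ℝ :=
  Polynomial.lsum fun i => (α + i + 1)⁻¹ • LinearMap.id

lemma moment_monomial (α : ℝ) (i : ℕ) (a : ℝ) : moment α (monomial i a) = (α + i + 1)⁻¹ * a := by
  simp [moment, Polynomial.lsum_apply]

lemma integral_rpow_mul_eval {α : ℝ} (hα : -1 < α) (p : ℝ[X]) :
    ∫ t in (0 : ℝ)..1, t ^ α * p.eval t = moment α p := by
  suffices IntervalIntegrable (fun t : ℝ => t ^ α * p.eval t) volume 0 1 ∧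
      ∫ t in (0 : ℝ)..1, t ^ α * p.eval t = moment α p from this.2
  induction p using Polynomial.induction_on' with
  | add p q hp hq =>
    simp only [eval_add, mul_add, map_add]
    exact ⟨hp.1.add hq.1, by rw [intervalIntegral.integral_add hp.1 hq.1, hp.2, hq.2]⟩
  | monomial i a =>
    have hi : -1 < α + i := by linarith [i.cast_nonneg (α := ℝ)]
    have hmul : Set.EqOn (fun t : ℝ => a * t ^ (α + i))
        (fun t : ℝ => t ^ α * (monomial i a).eval t) (Set.uIoc 0 1) := by
      rw [Set.uIoc_of_le zero_le_one]
      intro t ht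
      simp only [eval_monomial, Real.rpow_add ht.1, Real.rpow_natCast]
      ring
    refine ⟨((intervalIntegral.intervalIntegrable_rpow' hi).const_mul a).congr hmul, ?_⟩
    rw [← intervalIntegral.integral_congr_ae (Filter.Eventually.of_forall hmul),
      intervalIntegral.integral_const_mul, integral_rpow (Or.inl hi), moment_monomial,
      Real.one_rpow, Real.zero_rpow (by linarith)]
    ring

lemma moment_mul_X_pow (α : ℝ) (p : ℝ[X]) (i : ℕ) : moment α (p * X ^ i) = moment (α + i) p := by
  induction p using Polynomial.induction_on' with
  | add p q hp hq => rw [add_mul, map_add, hp, hq, map_add]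
  | monomial j a =>
    rw [monomial_mul_X_pow, moment_monomial, moment_monomial]
    congr 2
    push_cast
    ring

lemma moment_derivative {α : ℝ} (hα : -1 < α) (p : ℝ[X]) :
    moment (α + 1) (derivative p) = p.eval 1 - (α + 1) * moment α p := by
  induction p using Polynomial.induction_on' with
  | add p q hp hq =>
    simp only [map_add, eval_add, hp, hq]
    ring
  | monomial i a =>
    have hi : α + i + 1 ≠ 0 := by linarith [i.cast_nonneg (α := ℝ)]
    rw [derivative_monomial, moment_monomial, moment_monomial, eval_monomial, one_pow]
    cases i with
    | zero =>
      simp only [Nat.cast_zero, add_zero, mul_zero, mul_one] at hi ⊢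
      rw [mul_inv_cancel_left₀ hi, sub_self]
    | succ i =>
      rw [Nat.add_sub_cancel, show α + 1 + i + 1 = α + (i + 1 : ℕ) + 1 by push_cast; ring]
      field_simp
      push_cast
      ring

lemma moment_iterate_derivative {α : ℝ} (hα : -1 < α) {p : ℝ[X]} {s : ℕ}
    (hp : ∀ k < s, (derivative^[k] p).eval 1 = 0) :
    moment (α + s) (derivative^[s] p) = (-1) ^ s * poch (α + 1) s * moment α p := by
  induction s with
  | zero => simp [poch_zero]
  | succ s ih =>
    have hs : -1 < α + s := by linarith [s.cast_nonneg (α := ℝ)]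
    rw [Nat.cast_succ, ← add_assoc, Function.iterate_succ_apply', moment_derivative hs,
      hp s s.lt_succ_self, ih fun k hk => hp k (hk.trans s.lt_succ_self), poch_succ_right]
    ring

lemma one_sub_X_pow_eq (M : ℕ) : (1 - X : ℝ[X]) ^ M = C ((-1) ^ M) * (X - C 1) ^ M := by
  rw [C_pow, ← mul_pow]
  simp

lemma one_sub_X_pow_dvd_iff (M : ℕ) (p : ℝ[X]) :
    (1 - X) ^ M ∣ p ↔ ∀ k < M, (derivative^[k] p).eval 1 = 0 := by
  have hunit : IsUnit (C ((-1 : ℝ) ^ M)) := isUnit_C.mpr (isUnit_one.neg.pow M)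
  rw [one_sub_X_pow_eq, hunit.mul_left_dvd]
  by_cases hp : p = 0
  · simp [hp]
  rw [← le_rootMultiplicity_iff hp]
  cases M with
  | zero => simp
  | succ M =>
    rw [Nat.succ_le_iff, lt_rootMultiplicity_iff_isRoot_iterate_derivative hp]
    simp only [IsRoot.def, Nat.lt_succ_iff]

lemma one_sub_X_pow_mul_mem_degreeLT_iff (M K : ℕ) (r : ℝ[X]) :
    (1 - X) ^ M * r ∈ degreeLT ℝ (M + K) ↔ r ∈ degreeLT ℝ K := by
  have hdeg : ((1 - X : ℝ[X]) ^ M).degree = M := by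
    rw [one_sub_X_pow_eq, degree_C_mul (by simp), degree_pow, degree_X_sub_C, nsmul_one]
  rw [mem_degreeLT, mem_degreeLT, degree_mul, hdeg]
  by_cases hr : r = 0
  · simp [hr]
  · rw [degree_eq_natDegree hr]
    norm_cast
    omega

lemma iterate_derivative_eq_zero_of_mem_degreeLT {p : ℝ[X]} {K k : ℕ} (hp : p ∈ degreeLT ℝ K)
    (hk : K ≤ k) : derivative^[k] p = 0 := by
  by_cases hp0 : p = 0
  · rw [hp0, iterate_derivative_zero]
  · exact iterate_derivative_eq_zero
      (((natDegree_lt_iff_degree_lt hp0).mpr (mem_degreeLT.mp hp)).trans_le hk)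

/-- The polynomials of degree less than `K` that are orthogonal, for the bilinear form `B`, to the
polynomials of degree less than `K - 1`. For `K = n + 1` these are the orthogonal polynomials of
degree `n`, and for `K = 0` there are none but `0`. -/
def orthogonalLT (B : LinearMap.BilinForm ℝ ℝ[X]) (K : ℕ) : Submodule ℝ ℝ[X] :=
  degreeLT ℝ K ⊓ (degreeLT ℝ (K - 1)).orthogonalBilin B.flip

lemma mem_orthogonalLT {B : LinearMap.BilinForm ℝ ℝ[X]} {K : ℕ} {p : ℝ[X]} :
    p ∈ orthogonalLT B K ↔ p ∈ degreeLT ℝ K ∧ ∀ q ∈ degreeLT ℝ (K - 1), B p q = 0 :=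
  Iff.rfl

lemma forall_mem_degreeLT_eq_zero_iff {L : ℝ[X] →ₗ[ℝ] ℝ} {K : ℕ} :
    (∀ q ∈ degreeLT ℝ K, L q = 0) ↔ ∀ i < K, L (X ^ i) = 0 := by
  classical
  rw [degreeLT_eq_span_X_pow]
  change Submodule.span ℝ _ ≤ LinearMap.ker L ↔ _
  simp [Submodule.span_le, Set.subset_def]

lemma degreeLT_zero : degreeLT ℝ 0 = ⊥ :=
  eq_bot_iff.mpr fun p hp => by simpa [mem_degreeLT] using hp

lemma orthogonalLT_zero (B : LinearMap.BilinForm ℝ ℝ[X]) : orthogonalLT B 0 = ⊥ := by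
  rw [orthogonalLT, degreeLT_zero, bot_inf_eq]

/-- The form `∫_0^1 p q t^α (1 - t)^s dt`. -/
def jacobiForm (α : ℝ) (s : ℕ) : LinearMap.BilinForm ℝ ℝ[X] :=
  (LinearMap.mul ℝ ℝ[X]).compr₂ (moment α ∘ₗ LinearMap.mulLeft ℝ ((1 - X) ^ s))

lemma jacobiForm_apply (α : ℝ) (s : ℕ) (p q : ℝ[X]) :
    jacobiForm α s p q = moment α ((1 - X) ^ s * (p * q)) := rfl

/-- The Sobolev form `∫_0^1 p⁽ˢ⁾ q⁽ˢ⁾ t^(α+s) dt + ∑_{k<s} λ_k p⁽ᵏ⁾(1) q⁽ᵏ⁾(1)`. -/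
def sobolevForm (α : ℝ) (s : ℕ) (lam : ℕ → ℝ) : LinearMap.BilinForm ℝ ℝ[X] :=
  ((LinearMap.mul ℝ ℝ[X]).compr₂ (moment (α + s))).compl₁₂ (derivative ^ s) (derivative ^ s) +
    ∑ k ∈ Finset.range s, lam k •
      ((LinearMap.mul ℝ ℝ[X]).compr₂ (leval 1)).compl₁₂ (derivative ^ k) (derivative ^ k)

lemma sobolevForm_apply (α : ℝ) (s : ℕ) (lam : ℕ → ℝ) (p q : ℝ[X]) :
    sobolevForm α s lam p q = moment (α + s) (derivative^[s] p * derivative^[s] q) +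
      ∑ k ∈ Finset.range s, lam k * ((derivative^[k] p).eval 1 * (derivative^[k] q).eval 1) := by
  simp [sobolevForm, Module.End.pow_apply, LinearMap.sum_apply, leval_apply]

variable {α : ℝ} {s N : ℕ} {lam : ℕ → ℝ} {p : ℝ[X]}

lemma sobolevForm_of_dvd (hp : (1 - X) ^ s ∣ p) (q : ℝ[X]) :
    sobolevForm α s lam p q = moment (α + s) (derivative^[s] p * derivative^[s] q) := by
  rw [one_sub_X_pow_dvd_iff] at hp
  rw [sobolevForm_apply, Finset.sum_eq_zero fun k hk => ?_, add_zero]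
  rw [hp k (Finset.mem_range.mp hk), zero_mul, mul_zero]

lemma sobolevForm_X_pow_of_dvd (hα : -1 < α) (hp : (1 - X) ^ s ∣ p) (i : ℕ) :
    sobolevForm α s lam p (X ^ (i + s)) =
      (-1) ^ s * poch (α + i + 1) s * ((i + s).descFactorial s * moment α (p * X ^ i)) := by
  have hi : -1 < α + i := by linarith [i.cast_nonneg (α := ℝ)]
  rw [sobolevForm_of_dvd hp, iterate_derivative_X_pow_eq_smul, Nat.add_sub_cancel, mul_smul_comm,
    map_smul, moment_mul_X_pow, moment_mul_X_pow, add_right_comm,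
    moment_iterate_derivative hi ((one_sub_X_pow_dvd_iff s p).mp hp), smul_eq_mul]
  ring

lemma sobolevForm_orthogonal_iff_of_dvd (hα : -1 < α) (hp : (1 - X) ^ s ∣ p) (K : ℕ) :
    (∀ q ∈ degreeLT ℝ (s + K), sobolevForm α s lam p q = 0) ↔
      ∀ q ∈ degreeLT ℝ K, moment α (p * q) = 0 := by
  have hX : ∀ i, sobolevForm α s lam p (X ^ (i + s)) = 0 ↔ moment α (p * X ^ i) = 0 := fun i => by
    have hpoch : poch (α + i + 1) s ≠ 0 :=
      (poch_pos (by linarith [i.cast_nonneg (α := ℝ)]) s).ne'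
    have hfac : ((i + s).descFactorial s : ℝ) ≠ 0 := by
      exact_mod_cast Nat.descFactorial_eq_zero_iff_lt.not.mpr (by omega)
    rw [sobolevForm_X_pow_of_dvd hα hp]
    simp [hpoch, hfac]
  refine forall_mem_degreeLT_eq_zero_iff.trans (Iff.trans ?_
    (forall_mem_degreeLT_eq_zero_iff (L := moment α ∘ₗ LinearMap.mulLeft ℝ p)).symm)
  refine ⟨fun h i hi => (hX i).mp (h _ (by omega)), fun h i hi => ?_⟩
  rcases lt_or_ge i s with his | his
  · have hXi : derivative^[s] (X ^ i : ℝ[X]) = 0 := iterate_derivative_eq_zero (by simpa using his)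
    rw [sobolevForm_of_dvd hp, hXi, mul_zero, map_zero]
  · obtain ⟨j, rfl⟩ := Nat.exists_eq_add_of_le' his
    exact (hX j).mpr (h j (by omega))

lemma iterate_derivative_eval_one_of_sobolevForm (hlam : ∀ k < s, lam k ≠ 0)
    (h : ∀ q ∈ degreeLT ℝ N, sobolevForm α s lam p q = 0) {k : ℕ} (hks : k < s) (hkN : k < N) :
    (derivative^[k] p).eval 1 = 0 := by
  have hdeg : ((X - C 1 : ℝ[X]) ^ k).degree = k := by
    rw [degree_pow, degree_X_sub_C, nsmul_one]
  have heval : ∀ j, j ≠ k → (derivative^[j] ((X - C 1 : ℝ[X]) ^ k)).eval 1 = 0 := fun j hj => by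
    rw [iterate_derivative_X_sub_pow]
    rcases Nat.lt_or_gt_of_ne hj with hjk | hjk
    · simp [zero_pow (Nat.sub_ne_zero_of_lt hjk)]
    · simp [Nat.descFactorial_of_lt hjk]
  have hk := h ((X - C 1) ^ k) (mem_degreeLT.mpr (by rw [hdeg]; exact_mod_cast hkN))
  have hs : derivative^[s] ((X - C 1 : ℝ[X]) ^ k) = 0 :=
    iterate_derivative_eq_zero (by rwa [natDegree_eq_of_degree_eq_some hdeg])
  rw [sobolevForm_apply, hs, mul_zero, map_zero,
    zero_add, Finset.sum_eq_single_of_mem k (Finset.mem_range.mpr hks) fun j _ hj => by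
      rw [heval j hj, mul_zero, mul_zero], iterate_derivative_X_sub_pow_self] at hk
  simpa [hlam k hks, Nat.factorial_ne_zero] using hk

lemma orthogonalLT_sobolevForm_of_lt (hlam : ∀ k < s, lam k ≠ 0) (hN : N < s) :
    orthogonalLT (sobolevForm α s lam) (N + 1) = Submodule.span ℝ {(1 - X) ^ N} := by
  have hmem : (1 - X : ℝ[X]) ^ N ∈ degreeLT ℝ (N + 1) := by
    rw [← mul_one ((1 - X : ℝ[X]) ^ N), one_sub_X_pow_mul_mem_degreeLT_iff, mem_degreeLT]
    simp
  apply le_antisymm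
  · intro p hp
    obtain ⟨hp, hort⟩ := mem_orthogonalLT.mp hp
    obtain ⟨r, rfl⟩ := (one_sub_X_pow_dvd_iff N p).mpr fun k hk =>
      iterate_derivative_eval_one_of_sobolevForm hlam hort (hk.trans hN) hk
    rw [one_sub_X_pow_mul_mem_degreeLT_iff, mem_degreeLT] at hp
    rw [eq_C_of_degree_le_zero (Nat.WithBot.lt_one_iff_le_zero.mp hp), mul_comm, ← smul_eq_C_mul]
    exact Submodule.smul_mem _ _ (Submodule.mem_span_singleton_self _)
  · rw [Submodule.span_singleton_le_iff_mem, mem_orthogonalLT]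
    refine ⟨hmem, fun q hq => ?_⟩
    rw [sobolevForm_apply, iterate_derivative_eq_zero_of_mem_degreeLT hmem hN, zero_mul, map_zero,
      zero_add]
    refine Finset.sum_eq_zero fun k _ => ?_
    rcases lt_or_ge k N with hk | hk
    · rw [(one_sub_X_pow_dvd_iff N _).mp dvd_rfl k hk, zero_mul, mul_zero]
    · rw [iterate_derivative_eq_zero_of_mem_degreeLT hq hk, eval_zero, mul_zero, mul_zero]

lemma orthogonalLT_sobolevForm_of_le (hα : -1 < α) (hlam : ∀ k < s, lam k ≠ 0) (N : ℕ) :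
    orthogonalLT (sobolevForm α s lam) (s + (N + 1)) =
      (orthogonalLT (jacobiForm α s) (N + 1)).map (LinearMap.mulLeft ℝ ((1 - X) ^ s)) := by
  have hort : ∀ r : ℝ[X], (1 - X) ^ s * r ∈ orthogonalLT (sobolevForm α s lam) (s + (N + 1)) ↔
      r ∈ orthogonalLT (jacobiForm α s) (N + 1) := fun r => by
    rw [mem_orthogonalLT, mem_orthogonalLT, one_sub_X_pow_mul_mem_degreeLT_iff, ← add_assoc,
      Nat.add_sub_cancel, Nat.add_sub_cancel,
      sobolevForm_orthogonal_iff_of_dvd hα (dvd_mul_right _ _)]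
    simp only [jacobiForm_apply, mul_assoc]
  apply le_antisymm
  · intro p hp
    obtain ⟨r, rfl⟩ := (one_sub_X_pow_dvd_iff s p).mpr fun k hk =>
      iterate_derivative_eval_one_of_sobolevForm hlam (mem_orthogonalLT.mp hp).2 hk (by omega)
    exact ⟨r, (hort r).mp hp, rfl⟩
  · rintro _ ⟨r, hr, rfl⟩
    exact (hort r).mpr hr

lemma orthogonalLT_sobolevForm (hα : -1 < α) (hlam : ∀ k < s, lam k ≠ 0) (K : ℕ) :
    orthogonalLT (sobolevForm α s lam) K =
      (⨆ j : Fin s, if K = j + 1 then Submodule.span ℝ {(1 - X) ^ (j : ℕ)} else ⊥) ⊔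
        (orthogonalLT (jacobiForm α s) (K - s)).map (LinearMap.mulLeft ℝ ((1 - X) ^ s)) := by
  rcases le_or_gt K s with hK | hK
  · rw [Nat.sub_eq_zero_of_le hK, orthogonalLT_zero, Submodule.map_bot, sup_bot_eq]
    cases K with
    | zero => simp [orthogonalLT_zero]
    | succ N =>
      rw [orthogonalLT_sobolevForm_of_lt hlam hK]
      refine le_antisymm (le_iSup_of_le ⟨N, hK⟩ (if_pos rfl).ge) (iSup_le fun j => ?_)
      split_ifs with hj
      · rw [Nat.succ_injective hj]
      · exact bot_le
  · obtain ⟨N, rfl⟩ := Nat.exists_eq_add_of_le hK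
    have hbot : ∀ j : Fin s, s + 1 + N ≠ j + 1 := fun j => by omega
    simp only [hbot, if_false, iSup_bot, bot_sup_eq]
    rw [Nat.succ_add_eq_add_succ, orthogonalLT_sobolevForm_of_le hα hlam, Nat.add_sub_cancel_left]

lemma iSupIndep_ite_eq_succ {L : Type*} [CompleteLattice L] (V : ℕ → L) (s K : ℕ) :
    iSupIndep fun j : Fin s => if K = j + 1 then V j else ⊥ := by
  rw [iSupIndep_def]
  intro j
  by_cases hj : K = j + 1
  · have hbot : ⨆ i, ⨆ _ : i ≠ j, (if K = i + 1 then V i else ⊥) = ⊥ :=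
      iSup₂_eq_bot.mpr fun i hij => if_neg fun hi => hij (Fin.ext (by omega))
    rw [hbot]
    exact disjoint_bot_right
  · rw [if_neg hj]
    exact disjoint_bot_left

lemma disjoint_iSup_ite_eq_succ (V : ℕ → Submodule ℝ ℝ[X]) (B : LinearMap.BilinForm ℝ ℝ[X])
    (f : ℝ[X] →ₗ[ℝ] ℝ[X]) (s K : ℕ) :
    Disjoint (⨆ j : Fin s, if K = j + 1 then V j else ⊥) ((orthogonalLT B (K - s)).map f) := by
  rcases le_or_gt K s with hK | hK
  · rw [Nat.sub_eq_zero_of_le hK, orthogonalLT_zero, Submodule.map_bot]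
    exact disjoint_bot_right
  · have hbot : ∀ j : Fin s, K ≠ j + 1 := fun j => by omega
    simp only [hbot, if_false, iSup_bot, disjoint_bot_left]

end OneVariable

section Expansion

open MvPolynomial

variable {d : ℕ}

/-- The polynomial `p(t) y(x)`, as a bilinear function of `p` and `y`. -/
def mulTX : Polynomial ℝ →ₗ[ℝ] MvPolynomial (Fin d) ℝ →ₗ[ℝ] Poly d :=
  (LinearMap.mul ℝ (Poly d)).compl₁₂ (Polynomial.aeval (X none)).toLinearMap
    (rename some).toLinearMap

lemma mulTX_apply (p : Polynomial ℝ) (y : MvPolynomial (Fin d) ℝ) :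
    mulTX p y = Polynomial.aeval (X none) p * rename some y := rfl

lemma evalXT_mulTX (p : Polynomial ℝ) (y : MvPolynomial (Fin d) ℝ)
    (x : EuclideanSpace ℝ (Fin d)) (t : ℝ) : evalXT (mulTX p y) x t = p.eval t * evalX y x := by
  rw [evalXT, mulTX_apply, map_mul, eval_rename]
  congr 1
  rw [← coe_aeval_eq_eval, RingHom.coe_coe, ← Polynomial.aeval_algHom_apply, aeval_X,
    Polynomial.coe_aeval_eq_eval]
  rfl

lemma restrict_mulTX_apply (p : Polynomial ℝ) (y : MvPolynomial (Fin d) ℝ) (z : cone d) :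
    restrict d (mulTX p y) z = p.eval z.1.2 * evalX y z.1.1 :=
  evalXT_mulTX p y z.1.1 z.1.2

lemma pderiv_none_rename_some (y : MvPolynomial (Fin d) ℝ) :
    pderiv none (rename some y : Poly d) = 0 := by
  classical
  refine pderiv_eq_zero_of_notMem_vars fun h => ?_
  simpa using vars_rename some y h

lemma dt_mulTX (p : Polynomial ℝ) (y : MvPolynomial (Fin d) ℝ) :
    dt d (mulTX p y) = mulTX (Polynomial.derivative p) y := by
  simp [dt, mulTX_apply, pderiv_none_rename_some, Derivation.map_aeval, mul_comm]

lemma laplacianX_apply (P : Poly d) :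
    laplacianX d P = ∑ i, pderiv (some i) (pderiv (some i) P) := by
  simp [laplacianX]

lemma laplacianX_mulTX (p : Polynomial ℝ) (y : MvPolynomial (Fin d) ℝ) :
    laplacianX d (mulTX p y) = mulTX p (laplacian d y) := by
  have hpderiv : ∀ (i : Fin d) (z : MvPolynomial (Fin d) ℝ),
      pderiv (some i) (mulTX p z) = mulTX p (pderiv i z) := fun i z => by
    simp [mulTX_apply, Derivation.map_aeval, pderiv_rename (Option.some_injective (Fin d))]
  simp only [laplacianX_apply, hpderiv, laplacian_apply, map_sum]

lemma totalDegree_mulTX_le (p : Polynomial ℝ) (y : MvPolynomial (Fin d) ℝ) :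
    (mulTX p y).totalDegree ≤ p.natDegree + y.totalDegree := by
  rw [mulTX_apply]
  refine (totalDegree_mul _ _).trans (add_le_add ?_ (totalDegree_rename_le _ _))
  rw [Polynomial.aeval_eq_sum_range]
  refine totalDegree_finsetSum_le fun i hi => (totalDegree_smul_le _ _).trans ?_
  rw [totalDegree_X_pow]
  exact Nat.lt_succ_iff.mp (Finset.mem_range.mp hi)

lemma coeff_optionEquivLeft_pderiv (i : Fin d) (P : Poly d) (k : ℕ) :
    (optionEquivLeft ℝ (Fin d) (pderiv (some i) P)).coeff k =
      pderiv i ((optionEquivLeft ℝ (Fin d) P).coeff k) := by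
  ext e
  have he : e.optionElim k + Finsupp.single (some i) 1 =
      (e + Finsupp.single i 1).optionElim k := by
    classical
    ext o
    cases o with
    | none => simp
    | some j => simp [Finsupp.single_apply]
  rw [optionEquivLeft_coeff_coeff, coeff_pderiv, coeff_pderiv, optionEquivLeft_coeff_coeff, he]
  simp

lemma coeff_optionEquivLeft_laplacianX (P : Poly d) (k : ℕ) :
    (optionEquivLeft ℝ (Fin d) (laplacianX d P)).coeff k =
      laplacian d ((optionEquivLeft ℝ (Fin d) P).coeff k) := by
  simp only [laplacianX_apply, map_sum, Polynomial.finsetSum_coeff, coeff_optionEquivLeft_pderiv,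
    laplacian_apply]

lemma optionEquivLeft_mulTX (p : Polynomial ℝ) (y : MvPolynomial (Fin d) ℝ) :
    optionEquivLeft ℝ (Fin d) (mulTX p y) = p.map C * Polynomial.C y := by
  have hy : optionEquivLeft ℝ (Fin d) (rename some y) = Polynomial.C y := by
    induction y using MvPolynomial.induction_on with
    | C a => simp [optionEquivLeft_C]
    | add p q hp hq => simp [hp, hq]
    | mul_X p i hp => simp [hp, optionEquivLeft_X_some]
  have hp : optionEquivLeft ℝ (Fin d) (Polynomial.aeval (X none) p) = p.map C := by
    rw [← AlgEquiv.coe_toAlgHom, ← Polynomial.aeval_algHom_apply, AlgEquiv.coe_toAlgHom,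
      optionEquivLeft_X_none]
    exact Polynomial.aeval_X_left_eq_map p
  rw [mulTX_apply, map_mul, hp, hy]

lemma eq_sum_mulTX_homogeneousComponent (P : Poly d) :
    P = ∑ k ∈ (optionEquivLeft ℝ (Fin d) P).support,
      ∑ m ∈ Finset.range (((optionEquivLeft ℝ (Fin d) P).coeff k).totalDegree + 1),
        mulTX (Polynomial.X ^ k)
          (homogeneousComponent m ((optionEquivLeft ℝ (Fin d) P).coeff k)) := by
  simp only [← map_sum, sum_homogeneousComponent]
  apply (optionEquivLeft ℝ (Fin d)).injective
  simp only [map_sum, optionEquivLeft_mulTX, Polynomial.map_pow, Polynomial.map_X]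
  conv_lhs => rw [Polynomial.as_sum_support_C_mul_X_pow (optionEquivLeft ℝ (Fin d) P)]
  simp only [Polynomial.X_pow_mul_C]

lemma add_le_totalDegree_of_mem_support {P : Poly d} {k m : ℕ}
    (hk : k ∈ (optionEquivLeft ℝ (Fin d) P).support)
    (hm : m ∈ Finset.range (((optionEquivLeft ℝ (Fin d) P).coeff k).totalDegree + 1)) :
    k + m ≤ P.totalDegree := by
  have hkP : k ≤ P.totalDegree := (Polynomial.le_natDegree_of_mem_supp k hk).trans
    (by rw [natDegree_optionEquivLeft]; exact degreeOf_le_totalDegree P none)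
  have hcoeff := totalDegree_coeff_optionEquivLeft_add_le ℝ (Fin d) P k hkP
  rw [Finset.mem_range] at hm
  omega

variable {ι : Type*} {deg : ι → ℕ} (Y : ι → MvPolynomial (Fin d) ℝ)

/-- The polynomial `∑ c_i(t) Y_i(x)`. -/
def expansion : (ι →₀ Polynomial ℝ) →ₗ[ℝ] Poly d :=
  Finsupp.lsum ℝ fun i => mulTX.flip (Y i)

/-- The space of the polynomials `∑ c_i(t) Y_i(x)` with `c_i ∈ W_i`. -/
def harmonicSpan (W : ι → Submodule ℝ (Polynomial ℝ)) : Submodule ℝ (Poly d) :=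
  ⨆ i, (W i).map (mulTX.flip (Y i))

/-- The space of the functions `∑ c_i(t) Y_i(x)` on the cone with `c_i ∈ W_i`. -/
def coneSpan (W : ι → Submodule ℝ (Polynomial ℝ)) : Submodule ℝ (cone d → ℝ) :=
  (harmonicSpan Y W).map (restrict d)

variable {Y} {W W' : ι → Submodule ℝ (Polynomial ℝ)}

lemma expansion_single (i : ι) (p : Polynomial ℝ) :
    expansion Y (Finsupp.single i p) = mulTX p (Y i) := by
  rw [expansion, Finsupp.lsum_single, LinearMap.flip_apply]

lemma mulTX_mem_harmonicSpan {i : ι} {p : Polynomial ℝ} (hp : p ∈ W i) :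
    mulTX p (Y i) ∈ harmonicSpan Y W :=
  Submodule.mem_iSup_of_mem i ⟨p, hp, rfl⟩

lemma harmonicSpan_le_iff {S : Submodule ℝ (Poly d)} :
    harmonicSpan Y W ≤ S ↔ ∀ i, ∀ p ∈ W i, mulTX p (Y i) ∈ S := by
  rw [harmonicSpan, iSup_le_iff]
  exact forall_congr' fun i => Submodule.map_le_iff_le_comap

lemma mem_harmonicSpan_iff {P : Poly d} :
    P ∈ harmonicSpan Y W ↔ ∃ c : ι →₀ Polynomial ℝ, (∀ i, c i ∈ W i) ∧ expansion Y c = P := by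
  classical
  constructor
  · intro hP
    have hle : harmonicSpan Y W ≤ (Finsupp.submodule W).map (expansion Y) :=
      harmonicSpan_le_iff.mpr fun i p hp => ⟨Finsupp.single i p, fun j => by
        by_cases hij : i = j
        · subst hij
          rwa [Finsupp.single_eq_same]
        · rw [Finsupp.single_eq_of_ne' hij]
          exact zero_mem _, expansion_single i p⟩
    exact hle hP
  · rintro ⟨c, hc, rfl⟩
    rw [expansion, Finsupp.lsum_apply]
    exact sum_mem fun i _ => mulTX_mem_harmonicSpan (hc i)

lemma IsHarmonicBasis.mem_solidHarmonics (hY : IsHarmonicBasis deg Y) (i : ι) :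
    Y i ∈ solidHarmonics d (deg i) := by
  rw [hY.solidHarmonics_eq_span]
  exact Submodule.subset_span ⟨i, rfl, rfl⟩

lemma mulTX_mem_of_mem_solidHarmonics (hY : IsHarmonicBasis deg Y) {k m n : ℕ} (hkm : k + m < n)
    {y : MvPolynomial (Fin d) ℝ} (hy : y ∈ solidHarmonics d m) :
    mulTX (Polynomial.X ^ k) y ∈ harmonicSpan Y fun i => Polynomial.degreeLT ℝ (n - deg i) := by
  rw [hY.solidHarmonics_eq_span] at hy
  suffices hle : Submodule.span ℝ (Y '' {i | deg i = m}) ≤ (harmonicSpan Y fun i =>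
      Polynomial.degreeLT ℝ (n - deg i)).comap (mulTX (Polynomial.X ^ k)) from hle hy
  rw [Submodule.span_le]
  rintro _ ⟨i, rfl, rfl⟩
  refine mulTX_mem_harmonicSpan ?_
  rw [Polynomial.mem_degreeLT, Polynomial.degree_X_pow]
  exact_mod_cast Nat.lt_sub_of_add_lt hkm

lemma mem_harmonicSpan_degreeLT_iff (hY : IsHarmonicBasis deg Y) {P : Poly d} {n : ℕ} :
    P ∈ harmonicSpan Y (fun i => Polynomial.degreeLT ℝ (n + 1 - deg i)) ↔
      laplacianX d P = 0 ∧ P.totalDegree ≤ n := by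
  constructor
  · rw [← mem_restrictTotalDegree]
    refine fun hP => (harmonicSpan_le_iff (S := LinearMap.ker (laplacianX d) ⊓
      restrictTotalDegree (Option (Fin d)) ℝ n)).mpr (fun i p hp => ⟨?_, ?_⟩) hP
    · have hlap : laplacian d (Y i) = 0 := (hY.mem_solidHarmonics i).2
      rw [SetLike.mem_coe, LinearMap.mem_ker, laplacianX_mulTX, hlap, map_zero]
    · rw [SetLike.mem_coe, mem_restrictTotalDegree]
      rcases eq_or_ne p 0 with rfl | hp0
      · simp
      have hYi := IsHomogeneous.totalDegree_le (hY.mem_solidHarmonics i).1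
      have hpY := totalDegree_mulTX_le p (Y i)
      rw [Polynomial.mem_degreeLT, Polynomial.degree_eq_natDegree hp0, Nat.cast_lt] at hp
      omega
  · rintro ⟨hP, hn⟩
    rw [eq_sum_mulTX_homogeneousComponent P]
    refine sum_mem fun k hk => sum_mem fun m hm => mulTX_mem_of_mem_solidHarmonics hY
      (Nat.lt_succ_of_le ((add_le_totalDegree_of_mem_support hk hm).trans hn))
      (homogeneousComponent_mem_solidHarmonics ?_ m)
    rw [← coeff_optionEquivLeft_laplacianX, hP, map_zero, Polynomial.coeff_zero]

lemma mem_harmonicSpan_degreeLT_sub_iff (hY : IsHarmonicBasis deg Y) {P : Poly d} {n : ℕ} :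
    P ∈ harmonicSpan Y (fun i => Polynomial.degreeLT ℝ (n - deg i)) ↔
      P = 0 ∨ (laplacianX d P = 0 ∧ P.totalDegree < n) := by
  cases n with
  | zero => simp [harmonicSpan, degreeLT_zero]
  | succ n =>
    rw [mem_harmonicSpan_degreeLT_iff hY, Nat.lt_succ_iff]
    exact (or_iff_right_of_imp fun h => by simp [h]).symm

lemma restrict_mulTX_normSq_mul (p : Polynomial ℝ) (q : MvPolynomial (Fin d) ℝ) :
    restrict d (mulTX p (normSq d * q)) = restrict d (mulTX (p * Polynomial.X ^ 2) q) := by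
  funext z
  have hnorm : evalX (normSq d) z.1.1 = z.1.2 ^ 2 := by
    rw [← z.2.1, EuclideanSpace.norm_sq_eq]
    simp [evalX, normSq]
  rw [restrict_mulTX_apply, restrict_mulTX_apply, evalX_mul, hnorm, Polynomial.eval_mul,
    Polynomial.eval_pow, Polynomial.eval_X, mul_assoc]

lemma restrict_mulTX_mem_coneSpan [NeZero d] (hY : IsHarmonicBasis deg Y) {k m n : ℕ}
    (hkm : k + m < n) {y : MvPolynomial (Fin d) ℝ} (hy : y.IsHomogeneous m) :
    restrict d (mulTX (Polynomial.X ^ k) y) ∈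
      coneSpan Y fun i => Polynomial.degreeLT ℝ (n - deg i) := by
  have hharm : ∀ {k m : ℕ}, k + m < n → ∀ {y : MvPolynomial (Fin d) ℝ}, y ∈ solidHarmonics d m →
      restrict d (mulTX (Polynomial.X ^ k) y) ∈
        coneSpan Y fun i => Polynomial.degreeLT ℝ (n - deg i) := fun hkm _ hy =>
    Submodule.mem_map_of_mem (mulTX_mem_of_mem_solidHarmonics hY hkm hy)
  induction m using Nat.strong_induction_on generalizing k y with
  | _ m ih =>
    rcases lt_or_ge m 2 with hm | hm
    · exact hharm hkm ⟨hy, laplacian_eq_zero_of_isHomogeneous_of_lt hy hm⟩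
    · obtain ⟨j, rfl⟩ := Nat.exists_eq_add_of_le' hm
      obtain ⟨h, hh, q, hq, rfl⟩ := exists_eq_add_normSq_mul hy
      rw [map_add, map_add, restrict_mulTX_normSq_mul, ← pow_add]
      exact add_mem (hharm hkm hh) (ih j (by omega) (by omega) hq)

lemma restrict_mem_coneSpan [NeZero d] (hY : IsHarmonicBasis deg Y) {P : Poly d} {n : ℕ}
    (hn : P.totalDegree < n) :
    restrict d P ∈ coneSpan Y fun i => Polynomial.degreeLT ℝ (n - deg i) := by
  rw [eq_sum_mulTX_homogeneousComponent P, map_sum]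
  simp only [map_sum]
  exact sum_mem fun k hk => sum_mem fun m hm => restrict_mulTX_mem_coneSpan hY
    ((add_le_totalDegree_of_mem_support hk hm).trans_lt hn)
    (homogeneousComponent_isHomogeneous m _)

lemma coneSpan_sup : coneSpan Y (fun i => W i ⊔ W' i) = coneSpan Y W ⊔ coneSpan Y W' := by
  simp only [coneSpan, harmonicSpan, Submodule.map_sup, iSup_sup_eq]

lemma coneSpan_iSup {κ : Sort*} (V : κ → ι → Submodule ℝ (Polynomial ℝ)) :
    coneSpan Y (fun i => ⨆ j, V j i) = ⨆ j, coneSpan Y (V j) := by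
  simp only [coneSpan, harmonicSpan, Submodule.map_iSup]
  exact iSup_comm

lemma oneSubTPowMul_coneSpan (j : ℕ) :
    oneSubTPowMul d j (coneSpan Y W) = coneSpan Y fun i =>
      (W i).map (LinearMap.mulLeft ℝ ((1 - Polynomial.X) ^ j)) := by
  have hmul : ∀ i, LinearMap.mulLeft ℝ (fun z : cone d => (1 - z.1.2) ^ j) ∘ₗ restrict d ∘ₗ
      mulTX.flip (Y i) = restrict d ∘ₗ mulTX.flip (Y i) ∘ₗ
        LinearMap.mulLeft ℝ ((1 - Polynomial.X) ^ j) := fun i =>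
    LinearMap.ext fun p => funext fun z => by
      simp only [LinearMap.comp_apply, LinearMap.flip_apply, LinearMap.mulLeft_apply, Pi.mul_apply,
        restrict_mulTX_apply, Polynomial.eval_mul, Polynomial.eval_pow, Polynomial.eval_sub,
        Polynomial.eval_one, Polynomial.eval_X, mul_assoc]
  simp only [oneSubTPowMul, coneSpan, harmonicSpan, Submodule.map_iSup]
  refine iSup_congr fun i => ?_
  simp only [← Submodule.map_comp, hmul]

end Expansion

section InnerProducts

open MvPolynomial

variable {d : ℕ} {ι : Type*} {deg : ι → ℕ} {Y : ι → MvPolynomial (Fin d) ℝ}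

lemma dt_iterate_mulTX (k : ℕ) (p : Polynomial ℝ) (y : MvPolynomial (Fin d) ℝ) :
    (dt d)^[k] (mulTX p y) = mulTX (Polynomial.derivative^[k] p) y :=
  (Function.Semiconj.iterate_right (f := fun p => mulTX p y) (fun p => (dt_mulTX p y).symm) k
    p).symm

lemma dt_iterate_expansion (k : ℕ) (c : ι →₀ Polynomial ℝ) :
    (dt d)^[k] (expansion Y c) =
      expansion Y (Finsupp.mapRange.linearMap (Polynomial.derivative ^ k) c) := by
  suffices (dt d ^ k) ∘ₗ expansion Y = expansion Y ∘ₗ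
      Finsupp.mapRange.linearMap (Polynomial.derivative ^ k) by
    simpa only [LinearMap.comp_apply, Module.End.pow_apply] using LinearMap.congr_fun this c
  refine Finsupp.lhom_ext fun i p => ?_
  simp only [LinearMap.comp_apply, Module.End.pow_apply, expansion_single, dt_iterate_mulTX,
    Finsupp.mapRange.linearMap_apply, Finsupp.mapRange_single]

lemma evalXT_expansion_smul (hY : IsHarmonicBasis deg Y) (c : ι →₀ Polynomial ℝ) (r t : ℝ)
    (x : EuclideanSpace ℝ (Fin d)) :
    evalXT (expansion Y c) (r • x) t =
      evalX (c.sum fun i p => (r ^ deg i * p.eval t) • Y i) x := by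
  induction c using Finsupp.induction_linear with
  | zero => simp [evalXT, evalX]
  | add f g hf hg =>
    rw [map_add, evalXT_add, hf, hg, ← evalX_add, Finsupp.sum_add_index' (by simp)]
    intro i p q
    rw [Polynomial.eval_add, mul_add, add_smul]
  | single i p =>
    rw [expansion_single, evalXT_mulTX, evalX_smul_of_isHomogeneous (hY.mem_solidHarmonics i).1,
      Finsupp.sum_single_index (by simp), evalX_smul]
    ring

lemma sphereIntegral_expansion_mul (hY : IsHarmonicBasis deg Y) (c : ι →₀ Polynomial ℝ)
    (i : ι) (r t : ℝ) :
    sphereIntegral d (fun ξ => evalXT (expansion Y c) (r • ξ) t * evalX (Y i) ξ) =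
      r ^ deg i * (c i).eval t * sphereInner d (Y i) (Y i) := by
  simp only [evalXT_expansion_smul hY]
  rw [← sphereInner_apply, Finsupp.sum, map_sum, LinearMap.sum_apply]
  simp only [map_smul, LinearMap.smul_apply, smul_eq_mul]
  refine Finset.sum_eq_single i (fun j _ hj => ?_) fun hi => ?_
  · rw [hY.sphereInner_eq_zero j i hj, mul_zero]
  · rw [Finsupp.notMem_support_iff.mp hi, Polynomial.eval_zero, mul_zero, zero_mul]

lemma smul_mem_cone {t : ℝ} (ht : t ∈ Set.Ioc (0 : ℝ) 1)
    {ξ : EuclideanSpace ℝ (Fin d)} (hξ : ‖ξ‖ = 1) : (t • ξ, t) ∈ cone d := by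
  refine ⟨?_, ht.1.le, ht.2⟩
  rw [norm_smul, hξ, mul_one, Real.norm_of_nonneg ht.1.le]

lemma restrict_comp_expansion_injective (hY : IsHarmonicBasis deg Y) :
    Function.Injective (restrict d ∘ₗ expansion Y) := by
  refine (injective_iff_map_eq_zero _).mpr fun c hc => Finsupp.ext fun i => ?_
  refine Polynomial.eq_zero_of_infinite_isRoot _ ((Set.Ioc_infinite zero_lt_one).mono
    fun t (ht : t ∈ Set.Ioc (0 : ℝ) 1) => ?_)
  have hcoeff := sphereIntegral_expansion_mul hY c i t t
  have hzero : sphereIntegral d (fun ξ => evalXT (expansion Y c) (t • ξ) t * evalX (Y i) ξ) = 0 :=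
    integral_eq_zero_of_ae (Filter.Eventually.of_forall fun ξ =>
      mul_eq_zero_of_left (congrFun hc ⟨_, smul_mem_cone ht (norm_eq_of_mem_sphere ξ)⟩) _)
  rw [hzero, zero_eq_mul, mul_eq_zero] at hcoeff
  exact (hcoeff.resolve_right (hY.sphereInner_self_ne_zero i)).resolve_left
    (pow_ne_zero _ ht.1.ne')

lemma coneIntegral_congr {f g : EuclideanSpace ℝ (Fin d) → ℝ → ℝ}
    (h : ∀ z ∈ cone d, f z.1 z.2 = g z.1 z.2) : coneIntegral d f = coneIntegral d g := by
  refine intervalIntegral.integral_congr_ae (Filter.Eventually.of_forall fun t ht => ?_)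
  rw [Set.uIoc_of_le zero_le_one] at ht
  have hsphere : sphereIntegral d (fun ξ => f (t • ξ) t) = sphereIntegral d fun ξ => g (t • ξ) t :=
    integral_congr_ae (Filter.Eventually.of_forall fun ξ =>
      h _ (smul_mem_cone ht (norm_eq_of_mem_sphere ξ)))
  simp only [hsphere]

lemma coneIntegral_expansion_mul (hY : IsHarmonicBasis deg Y) (c : ι →₀ Polynomial ℝ)
    (i : ι) (q : Polynomial ℝ) (w : ℝ → ℝ) :
    coneIntegral d (fun x t => evalXT (expansion Y c) x t * evalXT (mulTX q (Y i)) x t * w t) =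
      sphereInner d (Y i) (Y i) *
        ∫ t in (0 : ℝ)..1, t ^ (d - 1) * (t ^ (2 * deg i) * (c i * q).eval t * w t) := by
  rw [← intervalIntegral.integral_const_mul, coneIntegral]
  refine intervalIntegral.integral_congr fun t _ => ?_
  have hmul : ∀ ξ : EuclideanSpace ℝ (Fin d), evalXT (expansion Y c) (t • ξ) t *
      evalXT (mulTX q (Y i)) (t • ξ) t * w t =
      (q.eval t * t ^ deg i * w t) * (evalXT (expansion Y c) (t • ξ) t * evalX (Y i) ξ) :=
    fun ξ => by
      rw [evalXT_mulTX, evalX_smul_of_isHomogeneous (hY.mem_solidHarmonics i).1]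
      ring
  simp only [hmul, sphereIntegral_const_mul, sphereIntegral_expansion_mul hY, Polynomial.eval_mul]
  ring

lemma integral_cone_rpow [NeZero d] {γ : ℝ} (hγ : -(d : ℝ) < γ) (m : ℕ) (p : Polynomial ℝ) :
    ∫ t in (0 : ℝ)..1, t ^ (d - 1) * (t ^ (2 * m) * p.eval t * t ^ γ) =
      moment (2 * m + γ + d - 1) p := by
  rw [← integral_rpow_mul_eval (by linarith [m.cast_nonneg (α := ℝ)]) p]
  refine intervalIntegral.integral_congr_ae (Filter.Eventually.of_forall fun t ht => ?_)
  rw [Set.uIoc_of_le zero_le_one] at ht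
  have hexp : 2 * (m : ℝ) + γ + d - 1 = ((d - 1 : ℕ) : ℝ) + ((2 * m : ℕ) : ℝ) + γ := by
    rw [Nat.cast_sub (NeZero.one_le (n := d))]
    push_cast
    ring
  rw [hexp, Real.rpow_add ht.1, Real.rpow_add ht.1, Real.rpow_natCast, Real.rpow_natCast]
  ring

lemma omega_pos [NeZero d] : 0 < omega d := by
  have hd : (0 : ℝ) < d / 2 := half_pos (Nat.cast_pos.mpr (NeZero.pos d))
  exact div_pos (by positivity) (Real.Gamma_pos_of_pos hd)

lemma normConst_pos [NeZero d] {β γ : ℝ} (hβ : -(d : ℝ) < β) (hγ : -1 < γ) :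
    0 < normConst d β γ :=
  mul_pos (one_div_pos.mpr omega_pos) (div_pos (Real.Gamma_pos_of_pos (by linarith))
    (mul_pos (Real.Gamma_pos_of_pos (by linarith)) (Real.Gamma_pos_of_pos (by linarith))))

lemma sobolevInner_comm (β : ℝ) (s : ℕ) (lam : ℕ → ℝ) (P Q : Poly d) :
    sobolevInner d β s lam P Q = sobolevInner d β s lam Q P := by
  simp only [sobolevInner, mul_comm (evalXT ((dt d)^[_] P) _ _)]

lemma coneInner_comm (β γ : ℝ) (P Q : Poly d) : coneInner d β γ P Q = coneInner d β γ Q P := by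
  simp only [coneInner, mul_comm (evalXT P _ _)]

/-- The Sobolev inner product on the cone as a bilinear form. -/
def sobolevBilin {β : ℝ} {s : ℕ} (hβ : -(d : ℝ) - s < β) (lam : ℕ → ℝ) :
    LinearMap.BilinForm ℝ (Poly d) :=
  LinearMap.mk₂ ℝ (sobolevInner d β s lam) (sobolevInner_add_left hβ lam)
    (sobolevInner_smul_left lam)
    (fun P Q Q' => by simp only [sobolevInner_comm β s lam P, sobolevInner_add_left hβ])
    (fun a P Q => by simp only [sobolevInner_comm β s lam P, sobolevInner_smul_left, smul_eq_mul])

/-- The Jacobi inner product on the cone as a bilinear form. -/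
def coneBilin {β γ : ℝ} (hβ : -(d : ℝ) < β) (hγ : -1 < γ) : LinearMap.BilinForm ℝ (Poly d) :=
  LinearMap.mk₂ ℝ (coneInner d β γ) (coneInner_add_left hβ hγ) coneInner_smul_left
    (fun P Q Q' => by simp only [coneInner_comm β γ P, coneInner_add_left hβ hγ])
    (fun a P Q => by simp only [coneInner_comm β γ P, coneInner_smul_left, smul_eq_mul])

lemma coneInner_congr_left (β γ : ℝ) {P P' : Poly d} (h : restrict d P = restrict d P')
    (Q : Poly d) : coneInner d β γ P Q = coneInner d β γ P' Q := by
  rw [coneInner, coneInner, coneIntegral_congr fun z hz => ?_]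
  rw [show evalXT P z.1 z.2 = evalXT P' z.1 z.2 from congrFun h ⟨z, hz⟩]

lemma sphereIntegral_dt_iterate_expansion_mul (hY : IsHarmonicBasis deg Y)
    (c : ι →₀ Polynomial ℝ) (i : ι) (q : Polynomial ℝ) (k : ℕ) :
    sphereIntegral d (fun ξ =>
        evalXT ((dt d)^[k] (expansion Y c)) ξ 1 * evalXT ((dt d)^[k] (mulTX q (Y i))) ξ 1) =
      sphereInner d (Y i) (Y i) * ((Polynomial.derivative^[k] (c i)).eval 1 *
        (Polynomial.derivative^[k] q).eval 1) := by
  have hcoeff := sphereIntegral_expansion_mul hY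
    (Finsupp.mapRange.linearMap (Polynomial.derivative ^ k) c) i 1 1
  rw [one_pow, one_mul, Finsupp.mapRange.linearMap_apply, Finsupp.mapRange_apply,
    Module.End.pow_apply, ← Finsupp.mapRange.linearMap_apply, ← dt_iterate_expansion] at hcoeff
  simp only [one_smul] at hcoeff
  simp only [dt_iterate_mulTX, evalXT_mulTX, mul_left_comm _ (Polynomial.eval _ _) (evalX _ _),
    sphereIntegral_const_mul, hcoeff]
  ring

lemma sobolevInner_expansion_mulTX [NeZero d] (hY : IsHarmonicBasis deg Y) {β : ℝ} {s : ℕ}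
    (hβ : -(d : ℝ) - s < β) (lam : ℕ → ℝ) (c : ι →₀ Polynomial ℝ) (i : ι) (q : Polynomial ℝ) :
    sobolevInner d β s lam (expansion Y c) (mulTX q (Y i)) =
      sphereInner d (Y i) (Y i) / omega d *
        sobolevForm (2 * deg i + β + d - 1) s lam (c i) q := by
  rw [sobolevInner, dt_iterate_expansion s, dt_iterate_mulTX s,
    coneIntegral_expansion_mul hY _ i _ fun t => t ^ (β + s), Finsupp.mapRange.linearMap_apply,
    Finsupp.mapRange_apply, Module.End.pow_apply, integral_cone_rpow (by linarith),
    show 2 * (deg i : ℝ) + (β + s) + d - 1 = 2 * deg i + β + d - 1 + s by ring, sobolevForm_apply,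
    mul_add, Finset.mul_sum]
  simp only [sphereIntegral_dt_iterate_expansion_mul hY]
  congr 1
  · ring
  · exact Finset.sum_congr rfl fun k _ => by ring

lemma coneInner_expansion_mulTX [NeZero d] (hY : IsHarmonicBasis deg Y) {β : ℝ}
    (hβ : -(d : ℝ) < β) (s : ℕ) (c : ι →₀ Polynomial ℝ) (i : ι) (q : Polynomial ℝ) :
    coneInner d β s (expansion Y c) (mulTX q (Y i)) =
      normConst d β s * sphereInner d (Y i) (Y i) *
        jacobiForm (2 * deg i + β + d - 1) s (c i) q := by
  rw [coneInner, coneIntegral_expansion_mul hY _ i _ (weight β s), jacobiForm_apply,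
    ← integral_cone_rpow hβ, mul_assoc]
  congr 3
  ext t
  simp only [weight, Real.rpow_natCast, Polynomial.eval_mul, Polynomial.eval_pow,
    Polynomial.eval_sub, Polynomial.eval_one, Polynomial.eval_X]
  ring

end InnerProducts

section Decomposition

open Polynomial

variable {d : ℕ} {ι : Type*} {deg : ι → ℕ} {Y : ι → MvPolynomial (Fin d) ℝ}
  {W W' : ι → Submodule ℝ ℝ[X]}

lemma mem_coneSpan_iff {f : cone d → ℝ} :
    f ∈ coneSpan Y W ↔ ∃ P ∈ harmonicSpan Y W, restrict d P = f :=
  Submodule.mem_map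

lemma disjoint_coneSpan (hY : IsHarmonicBasis deg Y) (h : ∀ i, Disjoint (W i) (W' i)) :
    Disjoint (coneSpan Y W) (coneSpan Y W') := by
  rw [Submodule.disjoint_def]
  rintro _ ⟨P, hP, rfl⟩ ⟨P', hP', hPP'⟩
  obtain ⟨c, hc, rfl⟩ := mem_harmonicSpan_iff.mp hP
  obtain ⟨c', hc', rfl⟩ := mem_harmonicSpan_iff.mp hP'
  obtain rfl := restrict_comp_expansion_injective hY hPP'
  have hzero : c' = 0 := Finsupp.ext fun i => Submodule.disjoint_def.mp (h i) _ (hc i) (hc' i)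
  rw [hzero, map_zero, map_zero]

lemma iSupIndep_coneSpan (hY : IsHarmonicBasis deg Y) {κ : Type*}
    {V : κ → ι → Submodule ℝ ℝ[X]} (h : ∀ i, iSupIndep fun j => V j i) :
    iSupIndep fun j => coneSpan Y (V j) := by
  intro j
  simp only [← coneSpan_iSup]
  exact disjoint_coneSpan hY fun i => h i j

lemma mem_harmonicSpan_orthogonalLT_iff {Φ : LinearMap.BilinForm ℝ (Poly d)}
    {B : ι → LinearMap.BilinForm ℝ ℝ[X]} {κ : ι → ℝ} (hκ : ∀ i, κ i ≠ 0)
    (hΦ : ∀ c i q, Φ (expansion Y c) (mulTX q (Y i)) = κ i * B i (c i) q) {K : ι → ℕ}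
    {P : Poly d} :
    P ∈ harmonicSpan Y (fun i => orthogonalLT (B i) (K i)) ↔
      P ∈ harmonicSpan Y (fun i => degreeLT ℝ (K i)) ∧
        ∀ Q ∈ harmonicSpan Y (fun i => degreeLT ℝ (K i - 1)), Φ P Q = 0 := by
  simp only [mem_harmonicSpan_iff (W := fun i => orthogonalLT (B i) (K i)),
    mem_harmonicSpan_iff (W := fun i => degreeLT ℝ (K i))]
  constructor
  · rintro ⟨c, hc, rfl⟩
    refine ⟨⟨c, fun i => (mem_orthogonalLT.mp (hc i)).1, rfl⟩, fun Q hQ => ?_⟩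
    refine (harmonicSpan_le_iff (S := LinearMap.ker (Φ (expansion Y c)))).mpr (fun i q hq => ?_) hQ
    rw [LinearMap.mem_ker, hΦ, (mem_orthogonalLT.mp (hc i)).2 q hq, mul_zero]
  · rintro ⟨⟨c, hc, rfl⟩, hort⟩
    refine ⟨c, fun i => mem_orthogonalLT.mpr ⟨hc i, fun q hq => ?_⟩, rfl⟩
    have hΦq := hort _ (mulTX_mem_harmonicSpan (i := i) hq)
    exact (mul_eq_zero.mp ((hΦ c i q).symm.trans hΦq)).resolve_left (hκ i)

lemma sobolevOrthPoly_eq_coneSpan [NeZero d] (hY : IsHarmonicBasis deg Y) {β : ℝ} {s : ℕ}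
    (hβ : -(d : ℝ) - s < β) (lam : ℕ → ℝ) (n : ℕ) :
    sobolevOrthPoly d β s hβ lam n = coneSpan Y fun i =>
      orthogonalLT (sobolevForm (2 * deg i + β + d - 1) s lam) (n + 1 - deg i) := by
  ext f
  rw [mem_coneSpan_iff]
  refine exists_congr fun P => ?_
  rw [mem_harmonicSpan_orthogonalLT_iff (Φ := sobolevBilin hβ lam)
    (fun i => div_ne_zero (hY.sphereInner_self_ne_zero i) omega_pos.ne')
    (sobolevInner_expansion_mulTX hY hβ lam), mem_harmonicSpan_degreeLT_iff hY]
  simp only [Nat.sub_right_comm _ (deg _), Nat.add_sub_cancel,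
    mem_harmonicSpan_degreeLT_sub_iff hY, or_imp, forall_and, forall_eq, map_zero, true_and]
  exact ⟨fun ⟨hlap, hn, hf, hort⟩ => ⟨⟨⟨hlap, hn⟩, fun Q hQ => hort Q hQ.1 hQ.2⟩, hf⟩,
    fun ⟨⟨⟨hlap, hn⟩, hort⟩, hf⟩ => ⟨hlap, hn, hf, fun Q hQ hQn => hort Q ⟨hQ, hQn⟩⟩⟩

lemma orthPoly_eq_coneSpan [NeZero d] (hY : IsHarmonicBasis deg Y) {β : ℝ} {s : ℕ}
    (hβ : -(d : ℝ) < β) (hs : -1 < (s : ℝ)) (n : ℕ) :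
    orthPoly d β s hβ hs n = coneSpan Y fun i =>
      orthogonalLT (jacobiForm (2 * deg i + β + d - 1) s) (n + 1 - deg i) := by
  have hort : ∀ P : Poly d, P ∈ harmonicSpan Y (fun i =>
      orthogonalLT (jacobiForm (2 * deg i + β + d - 1) s) (n + 1 - deg i)) ↔
      P ∈ harmonicSpan Y (fun i => degreeLT ℝ (n + 1 - deg i)) ∧
        ∀ Q ∈ harmonicSpan Y (fun i => degreeLT ℝ (n - deg i)), coneInner d β s P Q = 0 := by
    intro P
    rw [mem_harmonicSpan_orthogonalLT_iff (Φ := coneBilin hβ hs)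
      (fun i => mul_ne_zero (normConst_pos hβ hs).ne' (hY.sphereInner_self_ne_zero i))
      (coneInner_expansion_mulTX hY hβ s)]
    simp only [Nat.sub_right_comm _ (deg _), Nat.add_sub_cancel]
    rfl
  ext f
  rw [mem_coneSpan_iff]
  constructor
  · rintro ⟨P, hn, rfl, hP⟩
    obtain ⟨P', hP', hPP'⟩ := mem_coneSpan_iff.mp (restrict_mem_coneSpan hY (Nat.lt_succ_of_le hn))
    refine ⟨P', (hort P').mpr ⟨hP', fun Q hQ => ?_⟩, hPP'⟩
    rcases (mem_harmonicSpan_degreeLT_sub_iff hY).mp hQ with rfl | ⟨-, hQn⟩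
    · rw [coneInner_comm, coneInner_zero_left]
    · rw [coneInner_congr_left β s hPP', hP Q hQn]
  · rintro ⟨P, hP, rfl⟩
    obtain ⟨hPn, hPQ⟩ := (hort P).mp hP
    refine ⟨P, ((mem_harmonicSpan_degreeLT_iff hY).mp hPn).2, rfl, fun Q hQ => ?_⟩
    obtain ⟨Q', hQ', hQQ'⟩ := mem_coneSpan_iff.mp (restrict_mem_coneSpan hY hQ)
    rw [coneInner_comm, ← coneInner_congr_left β s hQQ', coneInner_comm, hPQ Q' hQ']

lemma coneSpan_eq_bot (h : ∀ i, W i = ⊥) : coneSpan Y W = ⊥ := by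
  simp only [coneSpan, harmonicSpan, h, Submodule.map_bot, iSup_bot]

lemma orthPolyInt_eq_coneSpan [NeZero d] (hY : IsHarmonicBasis deg Y) {β : ℝ} {s : ℕ}
    (hβ : -(d : ℝ) < β) (hs : -1 < (s : ℝ)) (n : ℕ) :
    orthPolyInt d β s hβ hs (n - s) = coneSpan Y fun i =>
      orthogonalLT (jacobiForm (2 * deg i + β + d - 1) s) (n + 1 - deg i - s) := by
  rcases lt_or_ge n s with hn | hn
  · rw [orthPolyInt, if_neg (by omega), coneSpan_eq_bot fun i => ?_]
    rw [show n + 1 - deg i - s = 0 by omega, orthogonalLT_zero]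
  · rw [orthPolyInt, if_pos (by omega), ← Nat.cast_sub hn, Int.toNat_natCast,
      orthPoly_eq_coneSpan hY]
    simp only [show ∀ i, n - s + 1 - deg i = n + 1 - deg i - s by omega]

lemma harmonicsOnCone_eq_coneSpan (hY : IsHarmonicBasis deg Y) (k : ℤ) :
    harmonicsOnCone d k =
      coneSpan Y fun i => if (deg i : ℤ) = k then Submodule.span ℝ {1} else ⊥ := by
  rcases lt_or_ge k 0 with hk | hk
  · rw [harmonicsOnCone, if_neg hk.not_ge, coneSpan_eq_bot fun i => if_neg (by omega)]
  lift k to ℕ using hk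
  have hone : ∀ y : MvPolynomial (Fin d) ℝ, mulTX 1 y = MvPolynomial.rename some y := fun y => by
    rw [mulTX_apply, map_one, one_mul]
  rw [harmonicsOnCone, if_pos (Int.natCast_nonneg k), Int.toNat_natCast,
    hY.solidHarmonics_eq_span, Submodule.span_eq_iSup_of_singleton_spans]
  simp only [coneSpan, harmonicSpan, iSup_image, Submodule.map_iSup, Submodule.map_span,
    Set.image_singleton, ← iSup_eq_if, Nat.cast_inj, Set.mem_ofPred_eq, LinearMap.flip_apply, hone,
    LinearMap.comp_apply, AlgHom.toLinearMap_apply]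

lemma oneSubTPowMul_harmonicsOnCone (hY : IsHarmonicBasis deg Y) (n j : ℕ) :
    oneSubTPowMul d j (harmonicsOnCone d (n - j)) = coneSpan Y fun i =>
      if n + 1 - deg i = j + 1 then Submodule.span ℝ {(1 - X) ^ j} else ⊥ := by
  rw [harmonicsOnCone_eq_coneSpan hY, oneSubTPowMul_coneSpan]
  congr 1
  ext1 i
  have hdeg : (deg i : ℤ) = n - j ↔ n + 1 - deg i = j + 1 := by omega
  simp only [← iSup_eq_if, Submodule.map_iSup, Submodule.map_span, Set.image_singleton,
    LinearMap.mulLeft_apply, mul_one, hdeg]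

lemma oneSubTPowMul_orthPolyInt [NeZero d] (hY : IsHarmonicBasis deg Y) {β : ℝ} {s : ℕ}
    (hβ : -(d : ℝ) < β) (hs : -1 < (s : ℝ)) (n : ℕ) :
    oneSubTPowMul d s (orthPolyInt d β s hβ hs (n - s)) = coneSpan Y fun i =>
      (orthogonalLT (jacobiForm (2 * deg i + β + d - 1) s) (n + 1 - deg i - s)).map
        (LinearMap.mulLeft ℝ ((1 - X) ^ s)) := by
  rw [orthPolyInt_eq_coneSpan hY, oneSubTPowMul_coneSpan]

end Decomposition

end ConeSobolev

end

theorem mainTheorem10_general (d s : ℕ) (hd : 1 ≤ d) (hs : 1 ≤ s) (β : ℝ)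
    (hβ : -(d : ℝ) - s < β) (lam : ℕ → ℝ) (hlam : ∀ k < s, lam k ≠ 0) :
    (∀ (n m : ℕ) (Y : MvPolynomial (Fin d) ℝ), m ≤ n →
      ∀ (x : EuclideanSpace ℝ (Fin d)) (t : ℝ),
        (s ≤ n - m → sobolevS d β s n m Y x t =
          bConst d β s n m * (1 - t) ^ s * coneS d β s (n - s) m Y x t) ∧
        (n - m < s → sobolevS d β s n m Y x t =
          2 ^ (n - m) / ((n - m).factorial : ℝ) * (1 - t) ^ (n - m) * evalX Y x)) ∧
    (∀ (hβ' : -(d : ℝ) < β) (hγ : -1 < (s : ℝ)) (n : ℕ),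
      sobolevOrthPoly d β s hβ lam n =
        (⨆ j : Fin s, oneSubTPowMul d j (harmonicsOnCone d ((n : ℤ) - (j : ℕ)))) ⊔
          oneSubTPowMul d s (orthPolyInt d β s hβ' hγ ((n : ℤ) - s)) ∧
      iSupIndep (fun j : Fin s => oneSubTPowMul d j (harmonicsOnCone d ((n : ℤ) - (j : ℕ)))) ∧
      Disjoint (⨆ j : Fin s, oneSubTPowMul d j (harmonicsOnCone d ((n : ℤ) - (j : ℕ))))
        (oneSubTPowMul d s (orthPolyInt d β s hβ' hγ ((n : ℤ) - s)))) := by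
  have : NeZero d := ⟨by omega⟩
  refine ⟨fun n m Y hmn x t => ⟨fun h => sobolevS_eq_coneS d β hs hmn h Y x t,
    fun h => sobolevS_of_lt d β h Y x t⟩, fun hβ' hγ n => ?_⟩
  obtain ⟨ι, deg, Y, hY⟩ := exists_isHarmonicBasis d
  have hα : ∀ i, -1 < 2 * (deg i : ℝ) + β + d - 1 := fun i => by
    linarith [(deg i).cast_nonneg (α := ℝ)]
  simp only [sobolevOrthPoly_eq_coneSpan hY, oneSubTPowMul_harmonicsOnCone hY,
    oneSubTPowMul_orthPolyInt hY]
  refine ⟨?_, iSupIndep_coneSpan hY fun i => iSupIndep_ite_eq_succ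
    (fun j => Submodule.span ℝ {(1 - Polynomial.X) ^ j}) s _, ?_⟩
  · simp only [orthogonalLT_sobolevForm (hα _) hlam, coneSpan_sup, coneSpan_iSup]
  · rw [← coneSpan_iSup]
    exact disjoint_coneSpan hY fun i => disjoint_iSup_ite_eq_succ
      (fun j => Submodule.span ℝ {(1 - Polynomial.X) ^ j}) _ _ s _

theorem mainTheorem10 (d s : ℕ) (hd : 1 ≤ d) (hs : 1 ≤ s) (β : ℝ) (hβ : -(d : ℝ) - s < β)
    (lam : ℕ → ℝ) (hlam : ∀ k < s, 0 < lam k)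
    (Y : ∀ m : ℕ, Module.Basis (Fin (Module.finrank ℝ (solidHarmonics d m))) ℝ (solidHarmonics d m))
    (hY : ∀ m ℓ ℓ', 1 / omega d * sphereIntegral d
        (fun ξ => evalX (Y m ℓ : MvPolynomial (Fin d) ℝ) ξ * evalX (Y m ℓ') ξ)
      = if ℓ = ℓ' then 1 else 0) :
    (∀ (n m : ℕ) (ℓ : Fin (Module.finrank ℝ (solidHarmonics d m))), m ≤ n →
      ∀ (x : EuclideanSpace ℝ (Fin d)) (t : ℝ),
        (s ≤ n - m → sobolevS d β s n m (Y m ℓ) x t =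
          bConst d β s n m * (1 - t) ^ s * coneS d β s (n - s) m (Y m ℓ) x t) ∧
        (n - m < s → sobolevS d β s n m (Y m ℓ) x t =
          2 ^ (n - m) / ((n - m).factorial : ℝ) * (1 - t) ^ (n - m) * evalX (Y m ℓ) x)) ∧
    (∀ (hβ' : -(d : ℝ) < β) (hγ : -1 < (s : ℝ)) (n : ℕ),
      sobolevOrthPoly d β s hβ lam n =
        (⨆ j : Fin s, oneSubTPowMul d j (harmonicsOnCone d ((n : ℤ) - (j : ℕ)))) ⊔
          oneSubTPowMul d s (orthPolyInt d β s hβ' hγ ((n : ℤ) - s)) ∧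
      iSupIndep (fun j : Fin s => oneSubTPowMul d j (harmonicsOnCone d ((n : ℤ) - (j : ℕ)))) ∧
      Disjoint (⨆ j : Fin s, oneSubTPowMul d j (harmonicsOnCone d ((n : ℤ) - (j : ℕ))))
        (oneSubTPowMul d s (orthPolyInt d β s hβ' hγ ((n : ℤ) - s)))) := by
  obtain ⟨hS, hV⟩ := mainTheorem10_general d s hd hs β hβ lam fun k hk => (hlam k hk).ne'
  exact ⟨fun n m ℓ hmn => hS n m (Y m ℓ) hmn, hV⟩
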